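/- Let $k$ be an algebraically closed field of characteristic $p>0$, let $V$ be a $k$-vector space of finite dimension $d$, and let $G\subset \mathrm{GL}(V)$ be a finite subgroup such that $p\nmid |G|$ and $G$ contains no pseudo-reflections (elements $g$ with $\operatorname{rank}(g-1)=1$). Let $S=\operatorname{Sym}(V)$, with the induced action of $G$, and let $R=S^G$. Let $V_0=k,V_1,\dots,V_n$ be a complete set of pairwise non-isomorphic irreducible representations of $G$ over $k$, and put $M_i=(S\otimes_k V_i)^G$ (so $M_0\cong R$), where $G$ acts diagonally. For an $R$-module $N$ and $e\in\mathbb{N}$, let ${}^eN$ denote the abelian group $N$ with the $R$-module structure $r\cdot x=r^{p^e}x$. Then for every $e\in\mathbb N$ and every $i$ there are decompositions of $R$-modules $${}^eR\cong\bigoplus_{j=0}^n M_j^{\oplus c_{j,e}},\qquad {}^eM_i\cong\bigoplus_{j=0}^n M_j^{\oplus d^i_{j,e}},$$ whose multiplicities $c_{j,e}$ and $d^i_{j,e}$ are uniquely determined; the limits $$s(R,M_j)=\lim_{e\to\infty}\frac{c_{j,e}}{p^{de}},\qquad s(M_i,M_j)=\lim_{e\to\infty}\frac{d^i_{j,e}}{p^{de}}$$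 exist; and for all $i,j=0,\dots,n$ $$s(M_i,M_j)=(\dim_kV_i)\cdot s(R,M_j)=\frac{(\dim_kV_i)(\dim_kV_j)}{|G|}=\frac{(\operatorname{rank}_RM_i)(\operatorname{rank}_RM_j)}{|G|}.$$ -/

import Mathlib

universe u v w

open scoped TensorProduct
open Filter Topology

noncomputable section

namespace GenFSig

/-! ### Invariant rings of finite linear groups and modules of covariants -/

section Invariants

variable {k : Type*} [Field k] {V : Type*} [AddCommGroup V] [Module k V]

/-- `g ∈ GL(V)` is a pseudo-reflection if its fixed subspace is a hyperplane, that is,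
if `g - 1` has rank one. -/
def IsPseudoReflection (g : LinearMap.GeneralLinearGroup k V) : Prop :=
  Module.finrank k (LinearMap.range ((g : V →ₗ[k] V) - LinearMap.id)) = 1

/-- The action of `g ∈ GL(V)` on `S = Sym(V)` by the algebra endomorphism extending
`g : V → V`. -/
def symAct (g : LinearMap.GeneralLinearGroup k V) :
    SymmetricAlgebra k V →ₐ[k] SymmetricAlgebra k V :=
  SymmetricAlgebra.lift (SymmetricAlgebra.ι k V ∘ₗ (g : V →ₗ[k] V))

/-- The invariant subring `R = S ^ G` of `S = Sym(V)`. -/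
def invariantRing (G : Subgroup (LinearMap.GeneralLinearGroup k V)) :
    Subalgebra k (SymmetricAlgebra k V) where
  carrier := {s | ∀ g ∈ G, symAct g s = s}
  mul_mem' ha hb g hg := by rw [map_mul, ha g hg, hb g hg]
  add_mem' ha hb g hg := by rw [map_add, ha g hg, hb g hg]
  algebraMap_mem' r g _ := (symAct g).commutes r

variable (G : Subgroup (LinearMap.GeneralLinearGroup k V))

/-- The invariant ring has the characteristic of the ground field, so that its iterated Frobenius
endomorphisms are available. -/
instance instExpCharInvariantRing (p : ℕ) [ExpChar k p] : ExpChar (invariantRing G) p :=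
  expChar_of_injective_algebraMap (algebraMap k (invariantRing G)).injective p

/-- The diagonal action of `g ∈ G` on `S ⊗ W`, for a representation `W` of `G`. -/
def diagAct {W : Type*} [AddCommGroup W] [Module k W] (ρ : Representation k G W) (g : G) :
    SymmetricAlgebra k V ⊗[k] W →ₗ[k] SymmetricAlgebra k V ⊗[k] W :=
  TensorProduct.map (symAct (g : LinearMap.GeneralLinearGroup k V)).toLinearMap (ρ g)

theorem diagAct_smul {W : Type*} [AddCommGroup W] [Module k W] (ρ : Representation k G W) (g : G)
    (r : invariantRing G) (x : SymmetricAlgebra k V ⊗[k] W) :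
    diagAct G ρ g (r • x) = r • diagAct G ρ g x := by
  induction x with
  | zero => simp
  | add x y hx hy => rw [smul_add, map_add, hx, hy, map_add, smul_add]
  | tmul s w =>
    simp only [diagAct, TensorProduct.smul_tmul', TensorProduct.map_tmul, Subalgebra.smul_def,
      smul_eq_mul, AlgHom.toLinearMap_apply, map_mul]
    rw [r.2 g g.2]

/-- The `R`-module `(S ⊗ W) ^ G` of invariants for the diagonal action. -/
def covariants {W : Type*} [AddCommGroup W] [Module k W] (ρ : Representation k G W) :
    Submodule (invariantRing G) (SymmetricAlgebra k V ⊗[k] W) where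
  carrier := {x | ∀ g : G, diagAct G ρ g x = x}
  zero_mem' g := map_zero _
  add_mem' ha hb g := by rw [map_add, ha g, hb g]
  smul_mem' r x hx g := by rw [diagAct_smul, hx g]

end Invariants

/-! ### Frobenius push-forwards and generalized `F`-signatures -/

/-- The module `ᵉM`: the abelian group `M`, on which a ring of characteristic `p` acts
through the `e`-th iterate of its Frobenius endomorphism. -/
def FrobPush (_p _e : ℕ) (M : Type*) : Type _ := M

instance (p e : ℕ) (M : Type*) [AddCommGroup M] : AddCommGroup (FrobPush p e M) :=
  inferInstanceAs (AddCommGroup M)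

instance (A : Type*) [CommRing A] (p e : ℕ) [ExpChar A p] (M : Type*) [AddCommGroup M]
    [Module A M] : Module A (FrobPush p e M) :=
  Module.compHom M (iterateFrobenius A p e)

section Signature

variable (A : Type*) [CommRing A] (p : ℕ) [ExpChar A p] {ι : Type*}
  (M : ι → Type*) [∀ j, AddCommGroup (M j)] [∀ j, Module A (M j)]
  (N : Type*) [AddCommGroup N] [Module A N]

/-- `ᵉN ≅ ⨁ⱼ Mⱼ ^ (c j)` as `A`-modules (used for finite index types, so that the product is the
direct sum). -/
def IsFrobDecomp (e : ℕ) (c : ι → ℕ) : Prop :=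
  Nonempty (FrobPush p e N ≃ₗ[A] ((j : ι) → Fin (c j) → M j))

open Classical in
/-- The multiplicity of `Mⱼ` in a decomposition `ᵉN ≅ ⨁ⱼ Mⱼ ^ (c j)`
(a default value if there is no such decomposition). -/
def frobMult (e : ℕ) : ι → ℕ :=
  if h : ∃ c, IsFrobDecomp A p M N e c then h.choose else 0

/-- The sequence `e ↦ (multiplicity of Mⱼ in ᵉN) / p ^ (d e)`. -/
def frobMultRatio (d : ℕ) (j : ι) (e : ℕ) : ℝ :=
  (frobMult A p M N e j : ℝ) / (p : ℝ) ^ (d * e)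

/-- The generalized `F`-signature `s(N, Mⱼ)`, the limit of
`(multiplicity of Mⱼ in ᵉN) / p ^ (d e)` as `e → ∞` (meaningful when the limit exists). -/
def genFSignature (d : ℕ) (j : ι) : ℝ :=
  limUnder atTop (frobMultRatio A p M N d j)

end Signature

end GenFSig

end

/-! Write `S = Sym(V)`, `q = p ^ e`, and let `I` be the ideal of `S` generated by the `q`-th powers
of linear forms. For a representation `U` put `F = (S ⊗ U) / I (S ⊗ U)`, of dimension `q ^ d * dim
U`.

Existence. As `|G|` is invertible, averaging gives an equivariant `k`-linear section of `S ⊗ U → F`.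
It extends to an equivariant isomorphism `S ⊗ ᵉF ≅ ᵉ(S ⊗ U)` of `S`-modules (`frobTriv_bijective`).
On invariants, `ᵉ` of the covariants of `U` becomes the module of covariants of `ᵉF`
(`nonempty_covariants_equiv_frobPush`), which Maschke's theorem decomposes.

Uniqueness. Without pseudo-reflections, an `R`-linear map between modules of covariants extends to
an equivariant `S`-linear map (`exists_extension`). Reducing modulo the irrelevant ideal turns
isomorphisms of covariants into isomorphisms of representations (`nonempty_equiv_of_covariants`). By
Schur's lemma the multiplicity of `M_j` is therefore `dim Hom_G(V_j, ᵉF)`.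

Limit. The main tool is the Vandermonde determinant `Δ` of the orbit of an element `v` of `S`. In a
module `Y` with semilinear action, `Δ y` is a combination of the traces of the `v ^ i y`, and the
powers of `v` are independent over the invariants up to `Δ`. Hence `|G| * dim Y^G` equals `dim Y` up
to a bounded multiple of `dim ker Δ`. This is applied to `Y = Hom_k(V_j, ᵉF)`, where `S` acts on `F`
before the Frobenius twist. Counting standard monomials bounds the kernel of `Δ` on `F` by a
constant times `q ^ (d - 1)` (`exists_mul_finrank_ker_le`), which vanishes after division by `q ^
d`.

The same determinants give the rank of the covariants (`finrank_covariants`). The absence of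
pseudo-reflections is what makes it possible to choose `v` with `Δ` outside a given principal prime
ideal (`exists_orbitDet_notMem`). -/

noncomputable section

namespace GenFSig

/-! ### Modules with a semilinear group action -/

section Semilinear

open Matrix

variable {k S G X X' : Type*} [CommRing k] [CommRing S] [Group G] [MulSemiringAction G S]
  [AddCommGroup X] [Module S X] [Module k X] [AddCommGroup X'] [Module S X'] [Module k X']

/-- A representation on an `S`-module is semilinear if it is compatible with the action of the
group on `S`. -/
def IsSemilinear (S : Type*) [CommRing S] [MulSemiringAction G S] [Module S X]
    (π : Representation k G X) : Prop :=
  ∀ (g : G) (s : S) (x : X), π g (s • x) = (g • s) • π g x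

/-- The Vandermonde matrix of the orbit of `v`. -/
def orbitVandermonde (G : Type*) [Group G] [Finite G] [MulSemiringAction G S] (v : S) :
    Matrix (Fin (Nat.card G)) (Fin (Nat.card G)) S :=
  vandermonde fun a => (Finite.equivFin G).symm a • v

/-- The Vandermonde determinant of the orbit of `v`. -/
def orbitDet (G : Type*) [Group G] [Finite G] [MulSemiringAction G S] (v : S) : S :=
  (orbitVandermonde G v).det

/-- The determinant is a product of differences of distinct conjugates of `v`, so a prime ideal
containing it contains one of these factors. -/
theorem orbitDet_notMem [Finite G] (P : Ideal S) [P.IsPrime] (v : S)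
    (hv : ∀ g h : G, g ≠ h → g • v - h • v ∉ P) : orbitDet G v ∉ P := by
  rw [orbitDet, orbitVandermonde, det_vandermonde, Ideal.IsPrime.prod_mem_iff]
  rintro ⟨i, -, hi⟩
  rw [Ideal.IsPrime.prod_mem_iff] at hi
  obtain ⟨j, hj, hij⟩ := hi
  refine hv _ _ (fun h => ?_) hij
  exact (Finset.mem_Ioi.1 hj).ne' ((Finite.equivFin G).symm.injective h)

theorem orbitVandermonde_apply [Finite G] (v : S) (a i : Fin (Nat.card G)) :
    orbitVandermonde G v a i = (Finite.equivFin G).symm a • v ^ (i : ℕ) := by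
  rw [orbitVandermonde, vandermonde_apply, smul_pow']

section Finite

variable [Fintype G] {π : Representation k G X} {π' : Representation k G X'}

theorem norm_apply (x : X) : π.norm x = ∑ g, π g x := by
  simp [Representation.norm]

theorem norm_smul_of_fixed (hπ : IsSemilinear S π) {s : S} (hs : ∀ g : G, g • s = s) (x : X) :
    π.norm (s • x) = s • π.norm x := by
  simp only [norm_apply, hπ _ s, hs, Finset.smul_sum]

theorem norm_smul_of_invariant (hπ : IsSemilinear S π) (s : S) {x : X} (hx : ∀ g, π g x = x) :
    π.norm (s • x) = (∑ g : G, g • s) • x := by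
  simp only [norm_apply, hπ _ s, hx, Finset.sum_smul]

theorem smul_sum_smul (s : S) (h : G) : h • ∑ g : G, g • s = ∑ g : G, g • s := by
  rw [Finset.smul_sum]
  simp only [smul_smul]
  exact Fintype.sum_bijective (h * ·) (Group.mulLeft_bijective h) _ _ fun _ => rfl

/-- The elements `x` of a semilinear representation are recovered, up to the Vandermonde
determinant, from the traces of the multiples of `x`. -/
theorem sum_adjugate_smul_norm (hπ : IsSemilinear S π) (v : S) (x : X) :
    ∑ i, (orbitVandermonde G v).adjugate i (Finite.equivFin G 1) • π.norm (v ^ (i : ℕ) • x) =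
      orbitDet G v • x := by
  set Q := orbitVandermonde G v with hQ
  have key : ∀ i : Fin (Nat.card G), π.norm (v ^ (i : ℕ) • x) =
      ∑ a, Q a i • π ((Finite.equivFin G).symm a) x := by
    intro i
    rw [norm_apply, ← (Finite.equivFin G).symm.sum_comp]
    refine Finset.sum_congr rfl fun a _ => ?_
    rw [hπ, hQ, orbitVandermonde_apply]
  simp only [key, Finset.smul_sum, smul_smul]
  rw [Finset.sum_comm]
  simp only [← Finset.sum_smul]
  -- This is the column of `Q * adj Q = det Q` at the identity of `G`, so only the conjugate of `x`
  -- by `1` survives.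
  have h1 : ∀ a, ∑ i, Q.adjugate i (Finite.equivFin G 1) * Q a i =
      if a = Finite.equivFin G 1 then orbitDet G v else 0 := by
    intro a
    have := congrFun (congrFun (mul_adjugate Q) a) (Finite.equivFin G 1)
    rw [mul_apply] at this
    simp only [mul_comm (Q.adjugate _ _), this, Matrix.smul_apply, one_apply, smul_eq_mul]
    split_ifs <;> simp [orbitDet, hQ]
  simp [h1]

/-- Nondegeneracy of the trace pairing `(t, x) ↦ ∑ g, g (t x)`, up to the Vandermonde determinant.
-/
theorem orbitDet_smul_eq_zero_of_norm (hπ : IsSemilinear S π) (v : S) {x : X}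
    (hx : ∀ t : S, π.norm (t • x) = 0) : orbitDet G v • x = 0 := by
  rw [← sum_adjugate_smul_norm hπ]
  simp [hx]

/-- Powers of `v` are independent over the invariants, up to the Vandermonde determinant. -/
theorem orbitDet_smul_eq_zero_of_sum (hπ : IsSemilinear S π) (v : S)
    {z : Fin (Nat.card G) → X} (hz : ∀ i g, π g (z i) = z i)
    (h0 : ∑ i : Fin (Nat.card G), v ^ (i : ℕ) • z i = 0) (i : Fin (Nat.card G)) :
    orbitDet G v • z i = 0 := by
  set Q := orbitVandermonde G v with hQ
  -- Applying every group element to the relation gives a linear system in the `z i` with matrix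
  -- `Q`; the adjugate solves it.
  have key : ∀ a, ∑ i, Q a i • z i = 0 := by
    intro a
    have := congrArg (π ((Finite.equivFin G).symm a)) h0
    rw [map_sum, map_zero] at this
    rw [← this]
    refine Finset.sum_congr rfl fun i _ => ?_
    rw [hπ, hz, hQ, orbitVandermonde_apply]
  have h1 : ∀ j, ∑ a, Q.adjugate i a * Q a j = if i = j then orbitDet G v else 0 := by
    intro j
    have := congrFun (congrFun (adjugate_mul Q) i) j
    rw [mul_apply] at this
    rw [this, Matrix.smul_apply, one_apply, smul_eq_mul]
    split_ifs <;> simp [orbitDet, hQ]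
  have h2 : ∑ a, Q.adjugate i a • ∑ j, Q a j • z j = 0 := by simp [key]
  simp only [Finset.smul_sum, smul_smul] at h2
  rw [Finset.sum_comm] at h2
  simp only [← Finset.sum_smul, h1] at h2
  simpa using h2

/-- A semilinear map is determined by its restriction to the invariants. -/
theorem eq_zero_of_invariants (hπ' : IsSemilinear S π')
    [IsDomain S] [Module.IsTorsionFree S X'] {v : S} (hv : orbitDet G v ≠ 0) (A : X →ₗ[S] X')
    (hA : ∀ g x, A (π g x) = π' g (A x)) (h0 : ∀ x, (∀ g, π g x = x) → A x = 0) : A = 0 := by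
  ext x
  -- The trace of `t • A x` is the image under `A` of an invariant, namely of the trace of `t • x`.
  have h1 : ∀ t : S, π'.norm (t • A x) = 0 := by
    intro t
    rw [← h0 (π.norm (t • x)) fun g => π.self_norm_apply g _, norm_apply, norm_apply, map_sum]
    exact Finset.sum_congr rfl fun g _ => by rw [hA, A.map_smul]
  exact (smul_eq_zero.1 (orbitDet_smul_eq_zero_of_norm hπ' v h1)).resolve_left hv

end Finite

/-- In a factorial domain divisibility by `D` can be checked after multiplication by a family of
elements without a common prime factor. -/
theorem dvd_of_forall_prime [IsDomain S] [UniqueFactorizationMonoid S] (D : S) (hD : D ≠ 0) :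
    ∀ z : S, (∀ f : S, Prime f → ∃ D', ¬ f ∣ D' ∧ D ∣ D' * z) → D ∣ z := by
  induction D using UniqueFactorizationMonoid.induction_on_prime with
  | h₁ => exact absurd rfl hD
  | h₂ x hx => exact fun z _ => hx.dvd
  | h₃ a f ha hf ih =>
    intro z hz
    obtain ⟨y, rfl⟩ := ih ha z fun f' hf' => by
      obtain ⟨D', h1, h2⟩ := hz f' hf'
      exact ⟨D', h1, (dvd_mul_left a f).trans h2⟩
    obtain ⟨D', h1, h2⟩ := hz f hf
    have h3 : f ∣ D' * y := by
      rw [show D' * (a * y) = a * (D' * y) by ring, mul_comm f a] at h2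
      exact (mul_dvd_mul_iff_left ha).1 h2
    obtain ⟨u, rfl⟩ := (hf.dvd_or_dvd h3).resolve_left h1
    exact ⟨u, by ring⟩

theorem exists_smul_eq_of_forall_prime [IsDomain S] [UniqueFactorizationMonoid S]
    [Module.Free S X] (D : S) (hD : D ≠ 0) (z : X)
    (hz : ∀ f : S, Prime f → ∃ D' : S, ¬ f ∣ D' ∧ ∃ y : X, D' • z = D • y) :
    ∃ y : X, z = D • y := by
  classical
  let b := Module.Free.chooseBasis S X
  have h : ∀ i, D ∣ b.repr z i := fun i => dvd_of_forall_prime D hD _ fun f hf => by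
    obtain ⟨D', h1, y, hy⟩ := hz f hf
    refine ⟨D', h1, b.repr y i, ?_⟩
    simpa using congrArg (fun x => b.repr x i) hy
  choose c hc using h
  refine ⟨b.repr.symm (Finsupp.onFinset (b.repr z).support c fun i hi => ?_), ?_⟩
  · rw [Finsupp.mem_support_iff, hc]
    exact mul_ne_zero hD hi
  · apply b.repr.injective
    ext i
    simp [hc]

/-- A map between the invariants of two semilinear representations which is linear over the
invariant ring extends to an equivariant linear map, when the group acts without inertia in
codimension one. -/
theorem exists_extension [Fintype G] {π : Representation k G X} {π' : Representation k G X'}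
    (hπ : IsSemilinear S π) (hπ' : IsSemilinear S π')
    [IsDomain S] [UniqueFactorizationMonoid S] [Module.Free S X']
    (hprime : ∀ f : S, Prime f → ∃ v : S, ¬ f ∣ orbitDet G v) (hzero : ∃ v : S, orbitDet G v ≠ 0)
    (α : π.invariants →+ π'.invariants)
    (hα : ∀ r : S, (∀ g : G, g • r = r) → ∀ x y : π.invariants, (y : X) = r • (x : X) →
      (α y : X') = r • (α x : X')) :
    ∃ A : X →ₗ[S] X', (∀ g x, A (π g x) = π' g (A x)) ∧ ∀ x : π.invariants, A x = α x := by
  obtain ⟨v₀, hv₀⟩ := hzero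
  let T : X → π.invariants := fun x => ⟨π.norm x, fun g => π.self_norm_apply g x⟩
  have Tadd : ∀ x y, T (x + y) = T x + T y := fun x y => Subtype.ext (map_add _ _ _)
  -- the relation defining the extension
  let Sol : X → X' → Prop := fun z z' => ∀ t : S, π'.norm (t • z') = α (T (t • z))
  have uniq : ∀ z z₁ z₂, Sol z z₁ → Sol z z₂ → z₁ = z₂ := by
    intro z z₁ z₂ h1 h2
    rw [← sub_eq_zero]
    refine (smul_eq_zero.1 (orbitDet_smul_eq_zero_of_norm hπ' v₀ fun t => ?_)).resolve_left hv₀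
    rw [smul_sub, map_sub, h1, h2, sub_self]
  have solsmul : ∀ (s : S) z z', Sol z z' → Sol (s • z) (s • z') := by
    intro s z z' h t
    rw [smul_smul, smul_smul, h]
  have soladd : ∀ z z' y y', Sol z z' → Sol y y' → Sol (z + y) (z' + y') := by
    intro z z' y y' h1 h2 t
    rw [smul_add, smul_add, map_add, Tadd, map_add, h1, h2, Submodule.coe_add]
  -- A solution for `Δ z` is explicit: this element is an `S`-combination of invariants, and the
  -- extension is forced on each of them.
  have exD : ∀ (v : S) (z : X), ∃ z', Sol (orbitDet G v • z) z' := by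
    intro v z
    let c : Fin (Nat.card G) → S :=
      fun i => (orbitVandermonde G v).adjugate i (Finite.equivFin G 1)
    let y : Fin (Nat.card G) → π.invariants := fun i => T (v ^ (i : ℕ) • z)
    have hz : orbitDet G v • z = ∑ i, c i • (y i : X) := (sum_adjugate_smul_norm hπ v z).symm
    refine ⟨∑ i, c i • (α (y i) : X'), fun t => ?_⟩
    let w : Fin (Nat.card G) → π.invariants := fun i => T ((t * c i) • (y i : X))
    have hw : T (t • orbitDet G v • z) = ∑ i, w i := by
      apply Subtype.ext
      rw [AddSubmonoidClass.coe_finsetSum, hz, Finset.smul_sum]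
      simp only [w, T, map_sum, smul_smul]
    have hαw : ∀ i, (α (w i) : X') = (∑ g : G, g • (t * c i)) • (α (y i) : X') := fun i =>
      hα _ (smul_sum_smul _) _ _ (norm_smul_of_invariant hπ _ (y i).2)
    rw [hw, map_sum, AddSubmonoidClass.coe_finsetSum, Finset.smul_sum, map_sum]
    refine Finset.sum_congr rfl fun i _ => ?_
    rw [hαw, smul_smul, norm_smul_of_invariant hπ' _ (α (y i)).2]
  have ex : ∀ z, ∃ z', Sol z z' := by
    intro z
    obtain ⟨y, hy⟩ := exD v₀ z
    -- To divide the solution for `Δ_{v₀} z` by `Δ_{v₀}`, compare it, for each prime `f`, with a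
    -- solution `y'` for `Δ_v z` where `f` does not divide `Δ_v`. Uniqueness gives `Δ_v y = Δ_{v₀}
    -- y'`.
    obtain ⟨z', rfl⟩ : ∃ z', y = orbitDet G v₀ • z' := by
      refine exists_smul_eq_of_forall_prime _ hv₀ y fun f hf => ?_
      obtain ⟨v, hv⟩ := hprime f hf
      obtain ⟨y', hy'⟩ := exD v z
      refine ⟨_, hv, y', uniq _ _ _ (solsmul _ _ _ hy) ?_⟩
      rw [smul_comm]
      exact solsmul _ _ _ hy'
    refine ⟨z', fun t => ?_⟩
    -- The product of the conjugates of `Δ_{v₀}` is an invariant multiple `Δ_{v₀} u`. Testing the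
    -- known relation against `t * u` pulls `E` out of both traces and of `α`, where it cancels.
    let E : S := ∏ g : G, g • orbitDet G v₀
    have hE : ∀ h : G, h • E = E := by
      intro h
      simp only [E, Finset.smul_prod', smul_smul]
      exact Fintype.prod_bijective (h * ·) (Group.mulLeft_bijective h) _ _ fun _ => rfl
    have hE0 : E ≠ 0 := Finset.prod_ne_zero_iff.2 fun g _ => by
      rwa [Ne, smul_eq_zero_iff_eq]
    have hdvd : orbitDet G v₀ ∣ E := by
      simpa using Finset.dvd_prod_of_mem (fun g : G => g • orbitDet G v₀) (Finset.mem_univ 1)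
    obtain ⟨u, hu⟩ := hdvd
    have h1 := hy (t * u)
    rw [smul_smul, smul_smul, mul_assoc, mul_comm u, ← hu, mul_comm t, ← smul_smul, ← smul_smul,
      norm_smul_of_fixed hπ' hE, hα E hE (T (t • z)) _ (norm_smul_of_fixed hπ hE _)] at h1
    exact smul_right_injective X' hE0 h1
  choose A hA using ex
  refine ⟨{ toFun := A, map_add' := fun x y => ?_, map_smul' := fun s x => ?_ }, fun g x => ?_,
    fun x => ?_⟩
  · exact uniq _ _ _ (hA _) (soladd _ _ _ _ (hA x) (hA y))
  · exact uniq _ _ _ (hA _) (solsmul _ _ _ (hA x))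
  · refine uniq _ _ _ (hA _) fun t => ?_
    have h1 : t • π' g (A x) = π' g ((g⁻¹ • t) • A x) := by rw [hπ', smul_inv_smul]
    have h2 : t • π g x = π g ((g⁻¹ • t) • x) := by rw [hπ, smul_inv_smul]
    change π'.norm (t • π' g (A x)) = _
    rw [h1, h2, π'.norm_self_apply, hA]
    exact congrArg (fun y => (α y : X')) (Subtype.ext (π.norm_self_apply _ _).symm)
  · refine uniq _ _ _ (hA _) fun t => ?_
    rw [norm_smul_of_invariant hπ' _ (α x).2]
    exact (hα _ (smul_sum_smul _) _ _ (norm_smul_of_invariant hπ _ x.2)).symm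

end Semilinear

/-! ### Dimension of the invariants of a semilinear representation -/

section Counting

variable {k S G Y : Type*} [Field k] [CommRing S] [Group G] [Fintype G] [MulSemiringAction G S]
  [AddCommGroup Y] [Module S Y] [Module k Y] [SMulCommClass k S Y]

/-- Multiplication by a scalar of a commuting action, as a linear map. -/
def smulMap (k : Type*) {S : Type*} (Y : Type*) [Field k] [CommRing S] [AddCommGroup Y]
    [Module S Y] [Module k Y] [SMulCommClass k S Y] (s : S) : Y →ₗ[k] Y where
  toFun y := s • y
  map_add' := smul_add s
  map_smul' c y := (smul_comm c s y).symm

@[simp]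
theorem smulMap_apply (s : S) (y : Y) : smulMap k Y s y = s • y := rfl

variable [FiniteDimensional k Y]

/-- The traces of the `v ^ i • y` give a map from `Y` to `|G|` copies of the invariants; its kernel
is killed by the determinant. -/
theorem finrank_le_card_mul_invariants {π : Representation k G Y} (hπ : IsSemilinear S π) (v : S) :
    Module.finrank k Y ≤ Nat.card G * Module.finrank k π.invariants +
      Module.finrank k (LinearMap.ker (smulMap k Y (orbitDet G v))) := by
  let β : Y →ₗ[k] (Fin (Nat.card G) → π.invariants) := LinearMap.pi fun i =>
    LinearMap.codRestrict _ (π.norm ∘ₗ smulMap k Y (v ^ (i : ℕ))) fun y g => π.self_norm_apply g _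
  have h1 := LinearMap.finrank_range_add_finrank_ker β
  have h2 : Module.finrank k (LinearMap.range β) ≤ Nat.card G * Module.finrank k π.invariants := by
    refine (Submodule.finrank_le _).trans ?_
    rw [Module.finrank_pi_fintype]
    simp
  have h3 : LinearMap.ker β ≤ LinearMap.ker (smulMap k Y (orbitDet G v)) := by
    intro y hy
    rw [LinearMap.mem_ker, smulMap_apply, ← sum_adjugate_smul_norm hπ v y]
    refine Finset.sum_eq_zero fun i _ => ?_
    have : π.norm (v ^ (i : ℕ) • y) = 0 := congrArg Subtype.val (congrFun hy i)
    rw [this, smul_zero]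
  have h4 := Submodule.finrank_mono h3
  omega

/-- Conversely `(z i) ↦ ∑ v ^ i • z i` maps `|G|` copies of the invariants to `Y`, and the
determinant kills every component of an element of the kernel. -/
theorem card_mul_invariants_le_finrank {π : Representation k G Y} (hπ : IsSemilinear S π) (v : S) :
    Nat.card G * Module.finrank k π.invariants ≤ Module.finrank k Y +
      Nat.card G * Module.finrank k (LinearMap.ker (smulMap k Y (orbitDet G v))) := by
  let α : (Fin (Nat.card G) → π.invariants) →ₗ[k] Y :=
    ∑ i : Fin (Nat.card G), smulMap k Y (v ^ (i : ℕ)) ∘ₗ π.invariants.subtype ∘ₗ LinearMap.proj i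
  have hα : ∀ z, α z = ∑ i : Fin (Nat.card G), v ^ (i : ℕ) • (z i : Y) := fun z => by
    simp [α, LinearMap.sum_apply]
  have h1 := LinearMap.finrank_range_add_finrank_ker α
  have h2 := Submodule.finrank_le (LinearMap.range α)
  let γ : LinearMap.ker α →ₗ[k]
      (Fin (Nat.card G) → LinearMap.ker (smulMap k Y (orbitDet G v))) := LinearMap.pi fun i =>
    LinearMap.codRestrict _ (π.invariants.subtype ∘ₗ LinearMap.proj i ∘ₗ
      (LinearMap.ker α).subtype) fun z => by
        refine orbitDet_smul_eq_zero_of_sum hπ v (z := fun i => (z.1 i : Y))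
          (fun i g => (z.1 i).2 g) ?_ i
        rw [← hα]
        exact z.2
  have hγ : Function.Injective γ := by
    intro z z' h
    apply Subtype.ext
    funext i
    have h' := congrArg Subtype.val (congrFun h i)
    exact Subtype.ext h'
  have h3 := LinearMap.finrank_le_finrank_of_injective hγ
  rw [Module.finrank_pi_fintype] at h1 h3
  simp only [Finset.sum_const, Finset.card_univ, Fintype.card_fin, smul_eq_mul] at h1 h3
  omega

end Counting

end GenFSig

namespace GenFSig

/-! ### The action on `Sym(V)` and general linear forms -/

section Concrete

variable {k : Type*} [Field k] {V : Type*} [AddCommGroup V] [Module k V]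

@[simp]
theorem symAct_ι (g : LinearMap.GeneralLinearGroup k V) (v : V) :
    symAct g (SymmetricAlgebra.ι k V v) = SymmetricAlgebra.ι k V ((g : V →ₗ[k] V) v) :=
  SymmetricAlgebra.lift_ι_apply _ _

theorem symAct_one : symAct (1 : LinearMap.GeneralLinearGroup k V) = AlgHom.id k _ :=
  SymmetricAlgebra.algHom_ext (LinearMap.ext fun v => by simp)

theorem symAct_mul (g h : LinearMap.GeneralLinearGroup k V) :
    symAct (g * h) = (symAct g).comp (symAct h) :=
  SymmetricAlgebra.algHom_ext (LinearMap.ext fun v => by simp)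

variable (G : Subgroup (LinearMap.GeneralLinearGroup k V))

instance : MulSemiringAction G (SymmetricAlgebra k V) where
  smul g s := symAct (g : LinearMap.GeneralLinearGroup k V) s
  one_smul s := congrArg (· s) (symAct_one (k := k) (V := V))
  mul_smul g h s := congrArg (· s) (symAct_mul (g : LinearMap.GeneralLinearGroup k V) h)
  smul_zero _ := map_zero (symAct _)
  smul_add _ := map_add (symAct _)
  smul_one _ := map_one (symAct _)
  smul_mul _ := map_mul (symAct _)

theorem group_smul_def (g : G) (s : SymmetricAlgebra k V) :
    g • s = symAct (g : LinearMap.GeneralLinearGroup k V) s := rfl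

theorem group_smul_ι (g : G) (v : V) :
    g • SymmetricAlgebra.ι k V v =
      SymmetricAlgebra.ι k V (((g : LinearMap.GeneralLinearGroup k V) : V →ₗ[k] V) v) :=
  symAct_ι _ _

theorem mem_invariantRing_iff {s : SymmetricAlgebra k V} :
    s ∈ invariantRing G ↔ ∀ g : G, g • s = s :=
  ⟨fun h g => h g g.2, fun h g hg => h ⟨g, hg⟩⟩

section Rep

variable {G} {W : Type*} [AddCommGroup W] [Module k W] (ρ : Representation k G W)

theorem diagAct_tmul (g : G) (s : SymmetricAlgebra k V) (w : W) :
    diagAct G ρ g (s ⊗ₜ w) = (g • s) ⊗ₜ ρ g w := rfl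

theorem diagAct_one : diagAct G ρ 1 = LinearMap.id :=
  TensorProduct.ext' fun s w => by
    rw [diagAct_tmul, one_smul, map_one, Module.End.one_apply, LinearMap.id_apply]

theorem diagAct_mul (g h : G) : diagAct G ρ (g * h) = diagAct G ρ g ∘ₗ diagAct G ρ h :=
  TensorProduct.ext' fun s w => by
    rw [LinearMap.comp_apply, diagAct_tmul, diagAct_tmul, diagAct_tmul, mul_smul, map_mul,
      Module.End.mul_apply]

/-- The diagonal representation of `G` on `S ⊗ W`. -/
def diagRep : Representation k G (SymmetricAlgebra k V ⊗[k] W) where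
  toFun := diagAct G ρ
  map_one' := diagAct_one ρ
  map_mul' g h := diagAct_mul ρ g h

@[simp]
theorem diagRep_tmul (g : G) (s : SymmetricAlgebra k V) (w : W) :
    diagRep ρ g (s ⊗ₜ w) = (g • s) ⊗ₜ ρ g w := rfl

theorem isSemilinear_diagRep : IsSemilinear (SymmetricAlgebra k V) (diagRep ρ) := by
  intro g s x
  induction x with
  | zero => simp
  | add x y hx hy => rw [smul_add, map_add, hx, hy, map_add, smul_add]
  | tmul t w => simp [TensorProduct.smul_tmul']

scoped instance : AddCommGroup (covariants G ρ) := Submodule.addCommGroup _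

scoped instance : Module (invariantRing G) (covariants G ρ) := Submodule.module _

scoped instance : SMul (invariantRing G) (covariants G ρ) := Submodule.smul _

end Rep

section Linear

variable {κ : Type*} (b : Module.Basis κ k V)

theorem equivMvPolynomial_ι (x : V) :
    SymmetricAlgebra.equivMvPolynomial b (SymmetricAlgebra.ι k V x) =
      (b.repr x).sum fun i c => MvPolynomial.monomial (Finsupp.single i 1) c := by
  conv_lhs => rw [← b.linearCombination_repr x, Finsupp.linearCombination_apply, Finsupp.sum]
  rw [map_sum, map_sum]
  refine Finset.sum_congr rfl fun i _ => ?_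
  rw [map_smul, map_smul, SymmetricAlgebra.equivMvPolynomial_ι_apply, MvPolynomial.X,
    MvPolynomial.smul_monomial, smul_eq_mul, mul_one]

theorem totalDegree_equivMvPolynomial_ι_le (x : V) :
    (SymmetricAlgebra.equivMvPolynomial b (SymmetricAlgebra.ι k V x)).totalDegree ≤ 1 := by
  rw [equivMvPolynomial_ι]
  refine MvPolynomial.totalDegree_finsetSum_le fun i _ => ?_
  refine (MvPolynomial.totalDegree_monomial_le _ _).trans ?_
  simp

theorem symmetricAlgebra_ι_injective : Function.Injective (SymmetricAlgebra.ι k V) := by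
  refine (injective_iff_map_eq_zero _).2 fun x hx => ?_
  let b := Module.Free.chooseBasis k V
  have h := equivMvPolynomial_ι b x
  rw [hx, map_zero] at h
  apply b.repr.injective
  ext i
  have h1 := congrArg (MvPolynomial.coeff (Finsupp.single i 1)) h
  classical
  rw [Finsupp.sum, MvPolynomial.coeff_sum] at h1
  simp only [MvPolynomial.coeff_monomial, MvPolynomial.coeff_zero,
    Finsupp.single_left_inj one_ne_zero] at h1
  simpa using h1.symm

/-- The linear forms divisible by a prime form a space of dimension at most one. -/
theorem exists_smul_eq_of_prime_dvd {f : SymmetricAlgebra k V} (hf : Prime f) {x y : V}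
    (hx0 : x ≠ 0) (hx : f ∣ SymmetricAlgebra.ι k V x) (hy : f ∣ SymmetricAlgebra.ι k V y) :
    ∃ c : k, c • x = y := by
  let φ := SymmetricAlgebra.equivMvPolynomial (Module.Free.chooseBasis k V)
  have hφf : Prime (φ f) := (MulEquiv.prime_iff φ.toMulEquiv).2 hf
  -- By degree, the cofactor of the nonconstant `f` in a linear form is a constant.
  have key : ∀ z : V, f ∣ SymmetricAlgebra.ι k V z → ∃ c : k, SymmetricAlgebra.ι k V z = c • f := by
    rintro z ⟨a, ha⟩
    by_cases ha0 : a = 0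
    · exact ⟨0, by rw [ha, ha0]; simp⟩
    have h1 : φ (SymmetricAlgebra.ι k V z) = φ f * φ a := by rw [ha, map_mul]
    have h2 := totalDegree_equivMvPolynomial_ι_le (Module.Free.chooseBasis k V) z
    change (φ _).totalDegree ≤ 1 at h2
    rw [h1, MvPolynomial.totalDegree_mul_of_isDomain hφf.ne_zero (by simpa using ha0)] at h2
    have h3 : (φ f).totalDegree ≠ 0 := by
      intro h
      rw [MvPolynomial.totalDegree_eq_zero_iff_eq_C] at h
      apply hφf.not_isUnit
      rw [h]
      refine (Ne.isUnit fun h0 => hφf.ne_zero ?_).map MvPolynomial.C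
      rw [h, h0, map_zero]
    have h4 : (φ a).totalDegree = 0 := by omega
    rw [MvPolynomial.totalDegree_eq_zero_iff_eq_C] at h4
    obtain ⟨c, h4⟩ : ∃ c, φ a = MvPolynomial.C c := ⟨_, h4⟩
    refine ⟨c, φ.injective ?_⟩
    rw [h1, h4, map_smul, mul_comm, MvPolynomial.smul_eq_C_mul]
  obtain ⟨c, hc⟩ := key x hx
  obtain ⟨c', hc'⟩ := key y hy
  have hc0 : c ≠ 0 := by
    rintro rfl
    exact hx0 (symmetricAlgebra_ι_injective (by simpa using hc))
  refine ⟨c' / c, symmetricAlgebra_ι_injective (k := k) ?_⟩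
  rw [map_smul, hc, hc', smul_smul, div_mul_cancel₀ _ hc0]

end Linear

section Avoid

variable [Infinite k] [FiniteDimensional k V] [Finite G]

/-- If a prime ideal contains at most a line of linear forms, and there are no pseudo-reflections,
then the orbit of a general linear form is distinct modulo the ideal. -/
theorem exists_orbitDet_notMem (hG : ∀ g ∈ G, ¬ IsPseudoReflection g)
    (P : Ideal (SymmetricAlgebra k V)) [P.IsPrime]
    (hP : ∀ x y : V, x ≠ 0 → SymmetricAlgebra.ι k V x ∈ P → SymmetricAlgebra.ι k V y ∈ P →
      ∃ c : k, c • x = y) :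
    ∃ v : V, orbitDet G (SymmetricAlgebra.ι k V v) ∉ P := by
  let L : Submodule k V := (P.restrictScalars k).comap (SymmetricAlgebra.ι k V)
  let a : G → V →ₗ[k] V := fun g => ((g : LinearMap.GeneralLinearGroup k V) : V →ₗ[k] V)
  have ha : ∀ g h : G, a (g * h) = a g ∘ₗ a h := fun _ _ => rfl
  -- `Z` consists of the `v` whose images under `g` and `h` agree modulo `P`. If it were everything,
  -- the range of `g h⁻¹ - 1` would lie in `L`, of dimension at most one: rank one is a
  -- pseudo-reflection, rank zero means `g = h`.
  let Z : {x : G × G // x.1 ≠ x.2} → Submodule k V := fun x => L.comap (a x.1.1 - a x.1.2)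
  have hZ : ∀ x, Z x ≠ ⊤ := by
    rintro ⟨⟨g, h⟩, hgh⟩ htop
    have h1 : ∀ v, a g v - a h v ∈ L := fun v => by
      have : v ∈ Z ⟨⟨g, h⟩, hgh⟩ := htop ▸ Submodule.mem_top
      exact this
    set γ := g * h⁻¹ with hγ
    have h2 : ∀ v, a γ v - v ∈ L := fun v => by
      have := h1 (a h⁻¹ v)
      rwa [← LinearMap.comp_apply, ← LinearMap.comp_apply, ← ha, ← ha, mul_inv_cancel] at this
    have hrange : LinearMap.range (a γ - LinearMap.id) ≤ L := by
      rintro _ ⟨v, rfl⟩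
      exact h2 v
    have hL : Module.finrank k L ≤ 1 := by
      by_cases hL0 : L = ⊥
      · rw [hL0]; simp
      obtain ⟨x, hx, hx0⟩ := Submodule.exists_mem_ne_zero_of_ne_bot hL0
      refine finrank_le_one (⟨x, hx⟩ : L) fun y => ?_
      obtain ⟨c, hc⟩ := hP x y hx0 hx y.2
      exact ⟨c, Subtype.ext hc⟩
    have hle := (Submodule.finrank_mono hrange).trans hL
    have hne : Module.finrank k (LinearMap.range (a γ - LinearMap.id)) ≠ 1 := hG γ γ.2
    have h0 : Module.finrank k (LinearMap.range (a γ - LinearMap.id)) = 0 := by omega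
    rw [Submodule.finrank_eq_zero, LinearMap.range_eq_bot, sub_eq_zero] at h0
    have : γ = 1 := Subtype.ext (Units.ext h0)
    exact hgh (mul_inv_eq_one.1 this)
  -- Over an infinite field, finitely many proper subspaces do not cover `V`.
  have hcover := Subspace.biUnion_ne_univ_of_top_notMem (k := k) (E := V)
    (s := Set.toFinite (Set.range Z) |>.toFinset) (by simpa using hZ)
  obtain ⟨v, hv⟩ := (Set.ne_univ_iff_exists_notMem _).1 hcover
  refine ⟨v, orbitDet_notMem P _ fun g h hgh hmem => hv ?_⟩
  simp only [Set.Finite.mem_toFinset, Set.mem_range, Set.mem_iUnion]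
  refine ⟨Z ⟨⟨g, h⟩, hgh⟩, ⟨_, rfl⟩, ?_⟩
  rw [group_smul_ι, group_smul_ι, ← map_sub] at hmem
  exact hmem

theorem exists_orbitDet_ne_zero (hG : ∀ g ∈ G, ¬ IsPseudoReflection g) :
    ∃ v : V, orbitDet G (SymmetricAlgebra.ι k V v) ≠ 0 := by
  obtain ⟨v, hv⟩ := exists_orbitDet_notMem G hG ⊥ fun x y hx0 hx _ =>
    absurd (symmetricAlgebra_ι_injective (by simpa using hx)) hx0
  exact ⟨v, by simpa using hv⟩

theorem exists_not_dvd_orbitDet (hG : ∀ g ∈ G, ¬ IsPseudoReflection g)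
    {f : SymmetricAlgebra k V} (hf : Prime f) :
    ∃ v : V, ¬ f ∣ orbitDet G (SymmetricAlgebra.ι k V v) := by
  have : (Ideal.span {f}).IsPrime := (Ideal.span_singleton_prime hf.ne_zero).2 hf
  obtain ⟨v, hv⟩ := exists_orbitDet_notMem G hG (Ideal.span {f}) fun x y hx0 hx hy =>
    exists_smul_eq_of_prime_dvd hf hx0 (Ideal.mem_span_singleton.1 hx)
      (Ideal.mem_span_singleton.1 hy)
  exact ⟨v, fun h => hv (Ideal.mem_span_singleton.2 h)⟩

end Avoid

instance [FiniteDimensional k V] : UniqueFactorizationMonoid (SymmetricAlgebra k V) :=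
  (SymmetricAlgebra.equivMvPolynomial (Module.Free.chooseBasis k V)).toMulEquiv.symm.uniqueFactorizationMonoid inferInstance

end Concrete

end GenFSig

namespace GenFSig

/-! ### Recovering a representation from its covariants -/

section Reflexive

variable {k : Type*} [Field k] {V : Type*} [AddCommGroup V] [Module k V]
  {G : Subgroup (LinearMap.GeneralLinearGroup k V)}
  {U : Type*} [AddCommGroup U] [Module k U] {ρ : Representation k G U}
  {U' : Type*} [AddCommGroup U'] [Module k U'] {ρ' : Representation k G U'}

theorem algebraMapInv_group_smul (g : G) (s : SymmetricAlgebra k V) :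
    SymmetricAlgebra.algebraMapInv (g • s) = SymmetricAlgebra.algebraMapInv s := by
  have : (SymmetricAlgebra.algebraMapInv (R := k) (M := V)).comp
      (symAct (g : LinearMap.GeneralLinearGroup k V)) = SymmetricAlgebra.algebraMapInv :=
    SymmetricAlgebra.algHom_ext (LinearMap.ext fun v => by
      simp [SymmetricAlgebra.algebraMapInv_ι])
  exact congrArg (· s) this

/-- Reduction of `S ⊗ U` modulo the irrelevant ideal of `S = Sym(V)`. -/
def reduction (V : Type*) [AddCommGroup V] [Module k V] (U : Type*) [AddCommGroup U] [Module k U] :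
    SymmetricAlgebra k V ⊗[k] U →ₗ[k] U :=
  TensorProduct.lift
    ((LinearMap.lsmul k U).comp (SymmetricAlgebra.algebraMapInv (R := k) (M := V)).toLinearMap)

@[simp]
theorem reduction_tmul (s : SymmetricAlgebra k V) (u : U) :
    reduction V U (s ⊗ₜ u) = SymmetricAlgebra.algebraMapInv s • u := rfl

theorem reduction_smul (s : SymmetricAlgebra k V) (x : SymmetricAlgebra k V ⊗[k] U) :
    reduction V U (s • x) = SymmetricAlgebra.algebraMapInv s • reduction V U x := by
  induction x with
  | zero => simp
  | add x y hx hy => rw [smul_add, map_add, hx, hy, map_add, smul_add]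
  | tmul t u => rw [TensorProduct.smul_tmul', reduction_tmul, reduction_tmul, smul_eq_mul, map_mul,
      mul_smul]

theorem reduction_diagRep (g : G) (x : SymmetricAlgebra k V ⊗[k] U) :
    reduction V U (diagRep ρ g x) = ρ g (reduction V U x) := by
  induction x with
  | zero => simp
  | add x y hx hy => rw [map_add, map_add, hx, hy, map_add, map_add]
  | tmul t u => rw [diagRep_tmul, reduction_tmul, reduction_tmul,
      algebraMapInv_group_smul, (ρ g).map_smul]

theorem reduction_one_tmul (u : U) : reduction (k := k) V U (1 ⊗ₜ u) = u := by
  rw [reduction_tmul, map_one, one_smul]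

/-- Modulo the irrelevant ideal, the coefficients of `x` can be replaced by their constant terms. By
linearity the reduction of `B x` thus depends only on the reduction of `x`, which makes reduction
functorial. -/
theorem reduction_map (B : SymmetricAlgebra k V ⊗[k] U →ₗ[SymmetricAlgebra k V]
    SymmetricAlgebra k V ⊗[k] U') (x : SymmetricAlgebra k V ⊗[k] U) :
    reduction V U' (B x) = reduction V U' (B (1 ⊗ₜ reduction (k := k) V U x)) := by
  induction x with
  | zero => simp
  | add x y hx hy => simp only [map_add, hx, hy, TensorProduct.tmul_add]
  | tmul t u =>
    have h1 : (t ⊗ₜ u : SymmetricAlgebra k V ⊗[k] U) = t • (1 ⊗ₜ u) := by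
      rw [TensorProduct.smul_tmul', smul_eq_mul, mul_one]
    have h2 : (1 ⊗ₜ reduction (k := k) V U (t ⊗ₜ u) : SymmetricAlgebra k V ⊗[k] U) =
        algebraMap k (SymmetricAlgebra k V) (SymmetricAlgebra.algebraMapInv t) •
          ((1 : SymmetricAlgebra k V) ⊗ₜ u) := by
      rw [TensorProduct.smul_tmul', smul_eq_mul, mul_one, reduction_tmul, ← TensorProduct.smul_tmul,
        Algebra.algebraMap_eq_smul_one]
    rw [h1, B.map_smul, reduction_smul, ← h1, h2, B.map_smul, reduction_smul,
      SymmetricAlgebra.algebraMap_leftInverse]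

/-- An equivariant `S`-linear map `S ⊗ U → S ⊗ U'` induces a map of representations. -/
def reductionMap (A : SymmetricAlgebra k V ⊗[k] U →ₗ[SymmetricAlgebra k V]
    SymmetricAlgebra k V ⊗[k] U') : U →ₗ[k] U' :=
  reduction V U' ∘ₗ A.restrictScalars k ∘ₗ TensorProduct.mk k (SymmetricAlgebra k V) U 1

theorem reductionMap_apply (A : SymmetricAlgebra k V ⊗[k] U →ₗ[SymmetricAlgebra k V]
    SymmetricAlgebra k V ⊗[k] U') (u : U) :
    reductionMap A u = reduction V U' (A (1 ⊗ₜ u)) := rfl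

theorem reductionMap_equivariant {A : SymmetricAlgebra k V ⊗[k] U →ₗ[SymmetricAlgebra k V]
    SymmetricAlgebra k V ⊗[k] U'} (hA : ∀ g x, A (diagRep ρ g x) = diagRep ρ' g (A x))
    (g : G) (u : U) : reductionMap A (ρ g u) = ρ' g (reductionMap A u) := by
  rw [reductionMap_apply, reductionMap_apply, ← reduction_diagRep, ← hA, diagRep_tmul, smul_one]

theorem reductionMap_leftInverse {A : SymmetricAlgebra k V ⊗[k] U →ₗ[SymmetricAlgebra k V]
    SymmetricAlgebra k V ⊗[k] U'} {B : SymmetricAlgebra k V ⊗[k] U' →ₗ[SymmetricAlgebra k V]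
    SymmetricAlgebra k V ⊗[k] U} (h : B ∘ₗ A = LinearMap.id) (u : U) :
    reductionMap B (reductionMap A u) = u := by
  rw [reductionMap_apply, reductionMap_apply, ← reduction_map, ← LinearMap.comp_apply, h,
    LinearMap.id_apply, reduction_one_tmul]

variable [Infinite k] [FiniteDimensional k V] [Finite G]

/-- The hypotheses of `exists_extension` hold because `Sym(V)` is factorial and each prime fails to
divide some Vandermonde determinant. -/
theorem exists_covariants_extension (hG : ∀ g ∈ G, ¬ IsPseudoReflection g)
    (α : covariants G ρ →ₗ[invariantRing G] covariants G ρ') :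
    ∃ A : SymmetricAlgebra k V ⊗[k] U →ₗ[SymmetricAlgebra k V] SymmetricAlgebra k V ⊗[k] U',
      (∀ g x, A (diagRep ρ g x) = diagRep ρ' g (A x)) ∧ ∀ x : covariants G ρ, A x = α x := by
  have := Fintype.ofFinite G
  let α' : (diagRep ρ).invariants →+ (diagRep ρ').invariants :=
    { toFun := fun x => ⟨α ⟨x.1, x.2⟩, (α ⟨x.1, x.2⟩).2⟩
      map_zero' := Subtype.ext (congrArg Subtype.val (map_zero α))
      map_add' := fun x y => Subtype.ext (congrArg Subtype.val (map_add α ⟨x.1, x.2⟩ ⟨y.1, y.2⟩)) }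
  obtain ⟨A, h1, h2⟩ := exists_extension (isSemilinear_diagRep ρ) (isSemilinear_diagRep ρ')
    (fun f hf => (exists_not_dvd_orbitDet G hG hf).imp' _ fun _ h => h)
    ((exists_orbitDet_ne_zero G hG).imp' _ fun _ h => h) α' fun r hr x y hxy => by
      have : (⟨y.1, y.2⟩ : covariants G ρ) =
          (⟨r, (mem_invariantRing_iff G).2 hr⟩ : invariantRing G) • (⟨x.1, x.2⟩ : covariants G ρ) := Subtype.ext hxy
      have h := congrArg Subtype.val (congrArg α this)
      rw [map_smul] at h
      exact h
  exact ⟨A, h1, fun x => h2 ⟨x.1, x.2⟩⟩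

theorem extension_comp_eq_id (hG : ∀ g ∈ G, ¬ IsPseudoReflection g)
    {A : SymmetricAlgebra k V ⊗[k] U →ₗ[SymmetricAlgebra k V] SymmetricAlgebra k V ⊗[k] U'}
    {B : SymmetricAlgebra k V ⊗[k] U' →ₗ[SymmetricAlgebra k V] SymmetricAlgebra k V ⊗[k] U}
    (hA : ∀ g x, A (diagRep ρ g x) = diagRep ρ' g (A x))
    (hB : ∀ g x, B (diagRep ρ' g x) = diagRep ρ g (B x))
    (h : ∀ x ∈ covariants G ρ, B (A x) = x) : B ∘ₗ A = LinearMap.id := by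
  have := Fintype.ofFinite G
  obtain ⟨v, hv⟩ := exists_orbitDet_ne_zero G hG
  rw [← sub_eq_zero]
  refine eq_zero_of_invariants (π := diagRep ρ) (isSemilinear_diagRep ρ) hv _ (fun g x => ?_)
    fun x hx => ?_
  · simp only [LinearMap.sub_apply, LinearMap.comp_apply, LinearMap.id_apply, hA, hB, map_sub]
  · rw [LinearMap.sub_apply, LinearMap.comp_apply, h x hx, LinearMap.id_apply, sub_self]

/-- Without pseudo-reflections, a representation is determined by its module of covariants. -/
theorem nonempty_equiv_of_covariants (hG : ∀ g ∈ G, ¬ IsPseudoReflection g)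
    (α : covariants G ρ ≃ₗ[invariantRing G] covariants G ρ') : Nonempty (ρ.Equiv ρ') := by
  obtain ⟨A, hA, hAα⟩ := exists_covariants_extension hG α.toLinearMap
  obtain ⟨B, hB, hBα⟩ := exists_covariants_extension hG α.symm.toLinearMap
  have hBA : B ∘ₗ A = LinearMap.id := extension_comp_eq_id hG hA hB fun x hx => by
    rw [hAα ⟨x, hx⟩, hBα]
    exact congrArg Subtype.val (α.symm_apply_apply ⟨x, hx⟩)
  have hAB : A ∘ₗ B = LinearMap.id := extension_comp_eq_id hG hB hA fun x hx => by
    rw [hBα ⟨x, hx⟩, hAα]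
    exact congrArg Subtype.val (α.apply_symm_apply ⟨x, hx⟩)
  exact ⟨Representation.Equiv.mk
    (LinearEquiv.ofLinearMap (reductionMap A) (reductionMap B)
      (LinearMap.ext (reductionMap_leftInverse hAB))
      (LinearMap.ext (reductionMap_leftInverse hBA)))
    fun g => LinearMap.ext fun u => reductionMap_equivariant hA g u⟩

end Reflexive

end GenFSig

namespace GenFSig

/-! ### Rank of the modules of covariants -/

section Rank

variable {k : Type*} [Field k] {V : Type*} [AddCommGroup V] [Module k V]
  {G : Subgroup (LinearMap.GeneralLinearGroup k V)}
  {W : Type*} [AddCommGroup W] [Module k W] (ρ : Representation k G W)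
  [Infinite k] [FiniteDimensional k V] [Finite G]

/-- Elements of a module of covariants which are independent over the invariant ring are
independent over the symmetric algebra. -/
theorem linearIndependent_of_covariants (hG : ∀ g ∈ G, ¬ IsPseudoReflection g)
    {κ : Type*} {m : κ → covariants G ρ} (hm : LinearIndependent (invariantRing G) m) :
    LinearIndependent (SymmetricAlgebra k V) fun i => (m i : SymmetricAlgebra k V ⊗[k] W) := by
  have := Fintype.ofFinite G
  obtain ⟨v, hv⟩ := exists_orbitDet_ne_zero G hG
  rw [linearIndependent_iff'] at hm ⊢
  intro s c hc i hi
  let r : κ → SymmetricAlgebra k V → invariantRing G := fun j t =>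
    ⟨∑ g : G, g • (t * c j), (mem_invariantRing_iff G).2 (smul_sum_smul _)⟩
  let π : Representation k G (SymmetricAlgebra k V) :=
    { toFun := fun g => (symAct (g : LinearMap.GeneralLinearGroup k V)).toLinearMap
      map_one' := congrArg AlgHom.toLinearMap symAct_one
      map_mul' := fun g h => congrArg AlgHom.toLinearMap (symAct_mul _ _) }
  have hπ : IsSemilinear (SymmetricAlgebra k V) π := fun g s x => smul_mul' g s x
  refine (smul_eq_zero.1 (orbitDet_smul_eq_zero_of_norm hπ _ fun t => ?_)).resolve_left hv
  -- Taking the trace of `t` times the relation gives one over the invariant ring, with coefficients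
  -- the traces of `t * c j`. These all vanish, so nondegeneracy yields `c i = 0`.
  have h1 : ∑ j ∈ s, r j t • m j = 0 := by
    apply Subtype.ext
    rw [AddSubmonoidClass.coe_finsetSum]
    have h2 := congrArg (fun x => (diagRep ρ).norm (t • x)) hc
    simp only [Finset.smul_sum, smul_smul, map_sum, smul_zero, map_zero] at h2
    refine Eq.trans (Finset.sum_congr rfl fun j _ => ?_) h2
    exact (norm_smul_of_invariant (isSemilinear_diagRep ρ) _ (m j).2).symm
  have h3 := congrArg Subtype.val (hm s (fun j => r j t) h1 i hi)
  rw [norm_apply]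
  exact h3

/-- The covariants span `S ⊗ W` over the fraction field of `S`, since a nonzero Vandermonde
determinant times any basis vector is an `S`-combination of traces. A basis is then extracted from
this spanning set. -/
theorem exists_linearIndependent_covariants [FiniteDimensional k W]
    (hG : ∀ g ∈ G, ¬ IsPseudoReflection g) :
    ∃ m : Fin (Module.finrank k W) → covariants G ρ, LinearIndependent (invariantRing G) m := by
  have := Fintype.ofFinite G
  obtain ⟨v, hv⟩ := exists_orbitDet_ne_zero G hG
  let S := SymmetricAlgebra k V
  let K := FractionRing S
  let b := (Module.finBasis k W).baseChange S
  let L : S ⊗[k] W →ₗ[S] (Fin (Module.finrank k W) → K) :=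
    LinearMap.pi fun i => (Algebra.linearMap S K) ∘ₗ b.coord i
  have hspan : Submodule.span K (L '' (covariants G ρ : Set (S ⊗[k] W))) = ⊤ := by
    set T := Submodule.span K (L '' (covariants G ρ : Set (S ⊗[k] W))) with hT
    rw [eq_top_iff, ← (Pi.basisFun K (Fin (Module.finrank k W))).span_eq, Submodule.span_le]
    rintro _ ⟨i, rfl⟩
    have h1 : L (orbitDet G (SymmetricAlgebra.ι k V v) • b i) ∈ T := by
      rw [← sum_adjugate_smul_norm (isSemilinear_diagRep ρ), map_sum]
      refine Submodule.sum_mem _ fun j _ => ?_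
      rw [L.map_smul, ← algebraMap_smul K]
      refine Submodule.smul_mem _ _ (Submodule.subset_span ⟨_, ?_, rfl⟩)
      exact fun g => (diagRep ρ).self_norm_apply g _
    have h2 : L (b i) = Pi.basisFun K (Fin (Module.finrank k W)) i := by
      funext j
      simp only [L, LinearMap.pi_apply, LinearMap.comp_apply, Module.Basis.coord_apply,
        Module.Basis.repr_self, Pi.basisFun_apply, Algebra.linearMap_apply]
      rw [Finsupp.single_apply, Pi.single_apply]
      simp only [eq_comm, apply_ite (algebraMap S K), map_one, map_zero]
    rw [L.map_smul, h2, ← algebraMap_smul K] at h1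
    have h3 : algebraMap S K (orbitDet G (SymmetricAlgebra.ι k V v)) ≠ 0 := by
      simpa using hv
    exact (Submodule.smul_mem_iff _ h3).1 h1
  obtain ⟨B, hB, hBspan, hBind⟩ := exists_linearIndependent K
    (L '' (covariants G ρ : Set (S ⊗[k] W)))
  let bB := Module.Basis.mk hBind (by rw [Subtype.range_coe, hBspan, hspan])
  have : Fintype B := FiniteDimensional.fintypeBasisIndex bB
  have hcard : Module.finrank k W = Fintype.card B := by
    rw [← Module.finrank_eq_card_basis bB, Module.finrank_fin_fun]
  choose f hf hfL using hB
  let e : Fin (Module.finrank k W) ≃ B := (finCongr hcard).trans (Fintype.equivFin B).symm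
  refine ⟨fun i => ⟨f (e i).2, hf _⟩, ?_⟩
  have h4 : LinearIndependent K fun i => L (f (e i).2) := by
    simp only [hfL]
    exact hBind.comp e e.injective
  rw [linearIndependent_iff'] at h4 ⊢
  intro s c hc i hi
  have h5 := congrArg (fun x : covariants G ρ => L x.1) hc
  have h6 : ∑ j ∈ s, algebraMap S K (c j) • L (f (e j).2) = 0 := by
    refine Eq.trans ?_ (h5.trans (map_zero L))
    simp only [AddSubmonoidClass.coe_finsetSum, map_sum]
    refine Finset.sum_congr rfl fun j _ => ?_
    rw [algebraMap_smul, ← L.map_smul]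
    rfl
  have h7 := h4 s (fun j => algebraMap S K (c j)) h6 i hi
  apply Subtype.ext
  simpa using h7

theorem finrank_covariants [FiniteDimensional k W] (hG : ∀ g ∈ G, ¬ IsPseudoReflection g) :
    Module.finrank (invariantRing G) (covariants G ρ) = Module.finrank k W := by
  apply Module.finrank_eq_of_rank_eq
  apply le_antisymm
  · refine rank_le fun s hs => ?_
    have h := (linearIndependent_of_covariants ρ hG hs).fintype_card_le_finrank
    rwa [Module.finrank_baseChange, Fintype.card_coe] at h
  · obtain ⟨m, hm⟩ := exists_linearIndependent_covariants ρ hG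
    simpa using hm.cardinal_lift_le_rank

end Rank

end GenFSig

namespace GenFSig

/-! ### Monomials and `q`-th powers in `Sym(V)` -/

section Monomials

variable {k : Type*} [Field k] {V : Type*} [AddCommGroup V] [Module k V]
  {κ : Type*} (b : Module.Basis κ k V)

theorem symmetricAlgebra_basis_apply (m : κ →₀ ℕ) :
    b.symmetricAlgebra m =
      (SymmetricAlgebra.equivMvPolynomial b).symm (MvPolynomial.monomial m 1) := by
  rw [Module.Basis.symmetricAlgebra, Module.Basis.map_apply, MvPolynomial.coe_basisMonomials]
  rfl

theorem symmetricAlgebra_basis_induction {motive : SymmetricAlgebra k V → Prop}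
    (s : SymmetricAlgebra k V) (zero : motive 0) (add : ∀ x y, motive x → motive y → motive (x + y))
    (smul : ∀ (c : k) x, motive x → motive (c • x))
    (mem : ∀ m, motive (b.symmetricAlgebra m)) : motive s := by
  have hs : s ∈ Submodule.span k (Set.range b.symmetricAlgebra) :=
    b.symmetricAlgebra.mem_span s
  induction hs using Submodule.span_induction with
  | mem x hx => obtain ⟨m, rfl⟩ := hx; exact mem m
  | zero => exact zero
  | add x y _ _ hx hy => exact add x y hx hy
  | smul c x _ hx => exact smul c x hx

theorem symmetricAlgebra_basis_zero : b.symmetricAlgebra 0 = 1 := by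
  rw [symmetricAlgebra_basis_apply]
  exact map_one _

theorem symmetricAlgebra_basis_add (m m' : κ →₀ ℕ) :
    b.symmetricAlgebra (m + m') = b.symmetricAlgebra m * b.symmetricAlgebra m' := by
  simp only [symmetricAlgebra_basis_apply]
  rw [← map_mul, MvPolynomial.monomial_mul, one_mul]

theorem symmetricAlgebra_basis_single (i : κ) (n : ℕ) :
    b.symmetricAlgebra (Finsupp.single i n) = SymmetricAlgebra.ι k V (b i) ^ n := by
  rw [symmetricAlgebra_basis_apply, ← SymmetricAlgebra.equivMvPolynomial_symm_X b i, ← map_pow,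
    MvPolynomial.X_pow_eq_monomial]

theorem symmetricAlgebra_basis_nsmul (m : κ →₀ ℕ) (q : ℕ) :
    b.symmetricAlgebra (q • m) = b.symmetricAlgebra m ^ q := by
  induction q with
  | zero => rw [zero_smul, pow_zero, symmetricAlgebra_basis_zero]
  | succ n ih => rw [succ_nsmul, symmetricAlgebra_basis_add, ih, pow_succ]

/-- The elements of degree at most `n` of the symmetric algebra. -/
def degreeLE (n : ℕ) : Submodule k (SymmetricAlgebra k V) :=
  Submodule.span k (b.symmetricAlgebra '' {m | m.degree ≤ n})

theorem basis_mem_degreeLE {m : κ →₀ ℕ} {n : ℕ} (h : m.degree ≤ n) :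
    b.symmetricAlgebra m ∈ degreeLE b n :=
  Submodule.subset_span ⟨m, h, rfl⟩

theorem degreeLE_mono {n n' : ℕ} (h : n ≤ n') : degreeLE b n ≤ degreeLE b n' :=
  Submodule.span_mono (Set.image_mono fun _ hm => le_trans hm h)

theorem mul_mem_degreeLE {n n' : ℕ} {s t : SymmetricAlgebra k V} (hs : s ∈ degreeLE b n)
    (ht : t ∈ degreeLE b n') : s * t ∈ degreeLE b (n + n') := by
  have h := Submodule.mul_mem_mul hs ht
  rw [degreeLE, degreeLE, Submodule.span_mul_span] at h
  refine Submodule.span_mono ?_ h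
  rintro _ ⟨_, ⟨m, hm, rfl⟩, _, ⟨m', hm', rfl⟩, rfl⟩
  refine ⟨m + m', ?_, symmetricAlgebra_basis_add b m m'⟩
  rw [Set.mem_ofPred_eq, map_add]
  exact add_le_add hm hm'

theorem ι_mem_degreeLE (v : V) : SymmetricAlgebra.ι k V v ∈ degreeLE b 1 := by
  rw [← b.linearCombination_repr v, Finsupp.linearCombination_apply, Finsupp.sum, map_sum]
  refine Submodule.sum_mem _ fun i _ => ?_
  rw [map_smul]
  refine Submodule.smul_mem _ _ ?_
  have := basis_mem_degreeLE b (m := Finsupp.single i 1) (n := 1) (by simp)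
  rwa [symmetricAlgebra_basis_single, pow_one] at this

theorem symAct_basis_mem_degreeLE (g : LinearMap.GeneralLinearGroup k V) (m : κ →₀ ℕ) :
    symAct g (b.symmetricAlgebra m) ∈ degreeLE b m.degree := by
  induction m using Finsupp.induction_linear with
  | zero =>
    rw [symmetricAlgebra_basis_zero, map_one, ← symmetricAlgebra_basis_zero b]
    exact basis_mem_degreeLE b le_rfl
  | add m m' hm hm' =>
    rw [symmetricAlgebra_basis_add, map_mul, map_add]
    exact mul_mem_degreeLE b hm hm'
  | single i n =>
    rw [symmetricAlgebra_basis_single, map_pow, symAct_ι, Finsupp.degree_single]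
    induction n with
    | zero =>
      rw [pow_zero, ← symmetricAlgebra_basis_zero b]
      exact basis_mem_degreeLE b (by simp)
    | succ n ih =>
      rw [pow_succ]
      exact mul_mem_degreeLE b ih (ι_mem_degreeLE b _)

theorem symAct_mem_degreeLE (g : LinearMap.GeneralLinearGroup k V) {n : ℕ}
    {s : SymmetricAlgebra k V} (hs : s ∈ degreeLE b n) : symAct g s ∈ degreeLE b n := by
  have : degreeLE b n ≤ (degreeLE b n).comap (symAct g).toLinearMap := by
    rw [degreeLE, Submodule.span_le]
    rintro _ ⟨m, hm, rfl⟩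
    exact degreeLE_mono b hm (symAct_basis_mem_degreeLE b g m)
  exact this hs

theorem exists_mem_degreeLE (s : SymmetricAlgebra k V) : ∃ n, s ∈ degreeLE b n := by
  induction s using symmetricAlgebra_basis_induction b with
  | zero => exact ⟨0, zero_mem _⟩
  | add x y hx hy =>
    obtain ⟨n, hn⟩ := hx
    obtain ⟨n', hn'⟩ := hy
    exact ⟨max n n', add_mem (degreeLE_mono b (le_max_left _ _) hn)
      (degreeLE_mono b (le_max_right _ _) hn')⟩
  | smul c x hx =>
    obtain ⟨n, hn⟩ := hx
    exact ⟨n, Submodule.smul_mem _ _ hn⟩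
  | mem m => exact ⟨_, basis_mem_degreeLE b le_rfl⟩

open Classical in
/-- The projection of the symmetric algebra onto the span of the monomials all of whose exponents
are less than `q`. -/
def boxProj (q : ℕ) : SymmetricAlgebra k V →ₗ[k] SymmetricAlgebra k V :=
  b.symmetricAlgebra.constr k fun m => if ∀ i, m i < q then b.symmetricAlgebra m else 0

theorem boxProj_of_forall {q : ℕ} {m : κ →₀ ℕ} (h : ∀ i, m i < q) :
    boxProj b q (b.symmetricAlgebra m) = b.symmetricAlgebra m := by
  rw [boxProj, Module.Basis.constr_basis, if_pos h]

theorem boxProj_of_le {q : ℕ} {m : κ →₀ ℕ} {i : κ} (h : q ≤ m i) :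
    boxProj b q (b.symmetricAlgebra m) = 0 := by
  rw [boxProj, Module.Basis.constr_basis, if_neg fun h' => (h' i).not_ge h]

theorem basis_eq_of_le {q : ℕ} {m : κ →₀ ℕ} {i : κ} (h : q ≤ m i) :
    b.symmetricAlgebra m = SymmetricAlgebra.ι k V (b i) ^ q *
      b.symmetricAlgebra (m - Finsupp.single i q) := by
  rw [← symmetricAlgebra_basis_single, ← symmetricAlgebra_basis_add,
    add_tsub_cancel_of_le (Finsupp.single_le_iff.2 h)]

/-- The ideal generated by the `q`-th powers of the linear forms. -/
def powIdeal (k V : Type*) [Field k] [AddCommGroup V] [Module k V] (q : ℕ) :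
    Ideal (SymmetricAlgebra k V) :=
  Ideal.span (Set.range fun v => SymmetricAlgebra.ι k V v ^ q)

theorem ι_pow_mem_powIdeal (v : V) (q : ℕ) : SymmetricAlgebra.ι k V v ^ q ∈ powIdeal k V q :=
  Ideal.subset_span ⟨v, rfl⟩

/-- Stability is immediate because `powIdeal` is generated by the powers of all linear forms, not
only of a basis. -/
theorem symAct_mem_powIdeal (g : LinearMap.GeneralLinearGroup k V) {q : ℕ}
    {s : SymmetricAlgebra k V} (hs : s ∈ powIdeal k V q) : symAct g s ∈ powIdeal k V q := by
  have : powIdeal k V q ≤ (powIdeal k V q).comap (symAct g) := by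
    rw [powIdeal, Ideal.span_le]
    rintro _ ⟨v, rfl⟩
    change symAct g _ ∈ powIdeal k V q
    rw [map_pow, symAct_ι]
    exact ι_pow_mem_powIdeal _ _
  exact this hs

theorem sub_boxProj_mem (q : ℕ) (s : SymmetricAlgebra k V) :
    s - boxProj b q s ∈ powIdeal k V q := by
  induction s using symmetricAlgebra_basis_induction b with
  | zero => simp
  | add x y hx hy => rw [map_add, add_sub_add_comm]; exact add_mem hx hy
  | smul c x hx =>
    rw [map_smul, ← smul_sub]
    exact (powIdeal k V q).smul_of_tower_mem c hx
  | mem m =>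
    by_cases h : ∀ i, m i < q
    · rw [boxProj_of_forall b h, sub_self]
      exact zero_mem _
    · push Not at h
      obtain ⟨i, hi⟩ := h
      rw [boxProj_of_le b hi, sub_zero, basis_eq_of_le b hi]
      exact Ideal.mul_mem_right _ _ (ι_pow_mem_powIdeal _ _)

section Char

variable (p : ℕ) [ExpChar k p]

instance instExpCharSymmetricAlgebra : ExpChar (SymmetricAlgebra k V) p :=
  expChar_of_injective_algebraMap (algebraMap k (SymmetricAlgebra k V)).injective p

/-- Frobenius is additive, so the `p ^ e`-th power of a linear form is a combination of powers of
the basis vectors, and multiplying by one of these raises an exponent to at least `p ^ e`. -/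
theorem boxProj_mul_ι_pow (e : ℕ) (t : SymmetricAlgebra k V) (v : V) :
    boxProj b (p ^ e) (t * SymmetricAlgebra.ι k V v ^ p ^ e) = 0 := by
  have h1 : ∀ i, boxProj b (p ^ e) (t * SymmetricAlgebra.ι k V (b i) ^ p ^ e) = 0 := by
    intro i
    induction t using symmetricAlgebra_basis_induction b with
    | zero => rw [zero_mul, map_zero]
    | add x y hx hy => rw [add_mul, map_add, hx, hy, add_zero]
    | smul c x hx => rw [smul_mul_assoc, map_smul, hx, smul_zero]
    | mem m =>
      rw [← symmetricAlgebra_basis_single, ← symmetricAlgebra_basis_add]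
      exact boxProj_of_le b (i := i) (by simp)
  have h2 : SymmetricAlgebra.ι k V v ^ p ^ e =
      ∑ i ∈ (b.repr v).support, (b.repr v i) ^ p ^ e • SymmetricAlgebra.ι k V (b i) ^ p ^ e := by
    conv_lhs => rw [← b.linearCombination_repr v, Finsupp.linearCombination_apply, Finsupp.sum]
    rw [map_sum, ← iterateFrobenius_def, map_sum]
    refine Finset.sum_congr rfl fun i _ => ?_
    rw [map_smul, iterateFrobenius_def, smul_pow]
  rw [h2, Finset.mul_sum, map_sum]
  refine Finset.sum_eq_zero fun i _ => ?_
  rw [mul_smul_comm, map_smul, h1, smul_zero]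

theorem boxProj_eq_zero (e : ℕ) {s : SymmetricAlgebra k V} (hs : s ∈ powIdeal k V (p ^ e)) :
    boxProj b (p ^ e) s = 0 := by
  rw [powIdeal, ← Ideal.submodule_span_eq] at hs
  have : ∀ t, boxProj b (p ^ e) (t * s) = 0 := by
    induction hs using Submodule.span_induction with
    | mem x hx =>
      obtain ⟨v, rfl⟩ := hx
      exact fun t => boxProj_mul_ι_pow b p e t v
    | zero => simp
    | add x y _ _ hx hy => exact fun t => by rw [mul_add, map_add, hx, hy, add_zero]
    | smul a x _ hx => exact fun t => by rw [smul_eq_mul, ← mul_assoc, hx]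
  simpa using this 1

theorem nsmul_add_inj {q : ℕ} {m m' a a' : κ →₀ ℕ} (ha : ∀ i, a i < q) (ha' : ∀ i, a' i < q) :
    q • m + a = q • m' + a' ↔ m = m' ∧ a = a' := by
  refine ⟨fun h => ?_, fun h => by rw [h.1, h.2]⟩
  have hi : ∀ i, q * m i + a i = q * m' i + a' i := fun i => by
    simpa using DFunLike.congr_fun h i
  have key : ∀ i, m i = m' i ∧ a i = a' i := by
    intro i
    have hq : 0 < q := (Nat.zero_le _).trans_lt (ha i)
    have h1 := congrArg (· / q) (hi i)
    have h2 := congrArg (· % q) (hi i)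
    simp only [Nat.mul_add_div hq, Nat.mul_add_mod, Nat.div_eq_of_lt (ha i),
      Nat.div_eq_of_lt (ha' i), Nat.mod_eq_of_lt (ha i), Nat.mod_eq_of_lt (ha' i)] at h1 h2
    exact ⟨h1, h2⟩
  exact ⟨Finsupp.ext fun i => (key i).1, Finsupp.ext fun i => (key i).2⟩

/-- Frobenius raises a polynomial to its `p ^ e`-th power term by term, and division with remainder
by `p ^ e` recovers `m` and `a` from the exponent `p ^ e • m + a`. -/
theorem repr_pow_mul_basis [DecidableEq (κ →₀ ℕ)] (e : ℕ) {m a a' : κ →₀ ℕ}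
    (ha : ∀ i, a i < p ^ e) (ha' : ∀ i, a' i < p ^ e) (c : SymmetricAlgebra k V) :
    b.symmetricAlgebra.repr (c ^ p ^ e * b.symmetricAlgebra a') (p ^ e • m + a) =
      if a' = a then b.symmetricAlgebra.repr c m ^ p ^ e else 0 := by
  have hp : p ^ e ≠ 0 := pow_ne_zero _ (expChar_ne_zero k p)
  induction c using symmetricAlgebra_basis_induction b with
  | zero => rw [zero_pow hp, zero_mul, map_zero, Finsupp.zero_apply, Finsupp.zero_apply,
      zero_pow hp, ite_self]
  | add x y hx hy =>
    rw [add_pow_expChar_pow, add_mul, map_add (b.symmetricAlgebra.repr) (_ * _),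
      map_add (b.symmetricAlgebra.repr) x, Finsupp.add_apply, Finsupp.add_apply,
      hx, hy, add_pow_expChar_pow]
    split_ifs <;> simp
  | smul c x hx =>
    rw [smul_pow, smul_mul_assoc, map_smul, map_smul, Finsupp.smul_apply, Finsupp.smul_apply, hx,
      smul_eq_mul, smul_eq_mul, mul_pow]
    split_ifs <;> simp
  | mem m' =>
    rw [← symmetricAlgebra_basis_nsmul, ← symmetricAlgebra_basis_add, Module.Basis.repr_self,
      Module.Basis.repr_self, Finsupp.single_apply, Finsupp.single_apply]
    simp only [nsmul_add_inj ha' ha]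
    by_cases h1 : m' = m <;> by_cases h2 : a' = a <;> simp [h1, h2, zero_pow hp]

/-- The monomials with exponents less than `p ^ e` are independent over the `p ^ e`-th powers. -/
theorem eq_zero_of_sum_pow_mul_basis (e : ℕ) {β : Type*} (s : Finset β) (a : β → κ →₀ ℕ)
    (hinj : Function.Injective a) (ha : ∀ x i, a x i < p ^ e) (c : β → SymmetricAlgebra k V)
    (h : ∑ x ∈ s, c x ^ p ^ e * b.symmetricAlgebra (a x) = 0) : ∀ x ∈ s, c x = 0 := by
  classical
  intro x hx
  have hp : p ^ e ≠ 0 := pow_ne_zero _ (expChar_ne_zero k p)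
  apply b.symmetricAlgebra.repr.injective
  ext m
  have h1 := congrArg (fun z => b.symmetricAlgebra.repr z (p ^ e • m + a x)) h
  simp only [map_sum, Finsupp.finsetSum_apply, repr_pow_mul_basis b p e (ha x) (ha _),
    hinj.eq_iff, map_zero, Finsupp.zero_apply, Finset.sum_ite_eq', hx, if_true] at h1
  simpa using (pow_eq_zero_iff hp).1 h1

end Char

end Monomials

end GenFSig

namespace GenFSig

/-! ### The fiber modulo `q`-th powers -/

section Fiber

variable {k : Type*} [Field k] {V : Type*} [AddCommGroup V] [Module k V]
  {G : Subgroup (LinearMap.GeneralLinearGroup k V)}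
  {W : Type*} [AddCommGroup W] [Module k W] (ρ : Representation k G W)

/-- The quotient of `S ⊗ W` by the ideal of `q`-th powers of linear forms. -/
def PowFiber (k V W : Type*) [Field k] [AddCommGroup V] [Module k V] [AddCommGroup W] [Module k W]
    (q : ℕ) : Type _ :=
  (SymmetricAlgebra k V ⊗[k] W) ⧸
    (powIdeal k V q • ⊤ : Submodule (SymmetricAlgebra k V) (SymmetricAlgebra k V ⊗[k] W))

namespace PowFiber

variable (q : ℕ)

instance : AddCommGroup (PowFiber k V W q) := Submodule.Quotient.addCommGroup _

instance : Module (SymmetricAlgebra k V) (PowFiber k V W q) := Submodule.Quotient.module _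

instance : Module k (PowFiber k V W q) := Submodule.Quotient.module' _

instance : IsScalarTower k (SymmetricAlgebra k V) (PowFiber k V W q) :=
  inferInstanceAs (IsScalarTower k (SymmetricAlgebra k V) ((SymmetricAlgebra k V ⊗[k] W) ⧸
    (powIdeal k V q • ⊤ : Submodule (SymmetricAlgebra k V) (SymmetricAlgebra k V ⊗[k] W))))

/-- The projection to the fiber. -/
def mk : SymmetricAlgebra k V ⊗[k] W →ₗ[SymmetricAlgebra k V] PowFiber k V W q :=
  Submodule.mkQ _

theorem mk_surjective : Function.Surjective (mk q : SymmetricAlgebra k V ⊗[k] W → _) :=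
  Submodule.mkQ_surjective _

theorem mk_eq_zero_iff {x : SymmetricAlgebra k V ⊗[k] W} :
    mk q x = 0 ↔ x ∈ (powIdeal k V q • ⊤ :
      Submodule (SymmetricAlgebra k V) (SymmetricAlgebra k V ⊗[k] W)) :=
  Submodule.Quotient.mk_eq_zero _

theorem mk_smul_of_tower (c : k) (x : SymmetricAlgebra k V ⊗[k] W) :
    mk q (c • x) = c • mk q x := rfl

variable {q}

/-- A linear map killing the multiples of the `q`-th powers descends to the fiber. -/
def lift {Z : Type*} [AddCommGroup Z] [Module k Z] (f : SymmetricAlgebra k V ⊗[k] W →ₗ[k] Z)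
    (hf : ∀ s ∈ powIdeal k V q, ∀ x, f (s • x) = 0) : PowFiber k V W q →ₗ[k] Z where
  toAddHom := (QuotientAddGroup.lift _ f.toAddMonoidHom fun x hx => by
    change x ∈ (powIdeal k V q • ⊤ :
      Submodule (SymmetricAlgebra k V) (SymmetricAlgebra k V ⊗[k] W)) at hx
    change f x = 0
    induction hx using Submodule.smul_induction_on' with
    | smul s hs y _ => exact hf s hs y
    | add x _ y _ hx hy => rw [map_add, hx, hy, add_zero] :
      PowFiber k V W q →+ Z).toAddHom
  map_smul' c y := by
    obtain ⟨x, rfl⟩ := mk_surjective q y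
    exact f.map_smul c x

theorem mk_smul_of_mem {s : SymmetricAlgebra k V} (hs : s ∈ powIdeal k V q)
    (x : SymmetricAlgebra k V ⊗[k] W) : mk q (s • x) = 0 :=
  (mk_eq_zero_iff q).2 (Submodule.smul_mem_smul hs Submodule.mem_top)

theorem lift_hypothesis (g : G) (s : SymmetricAlgebra k V) (hs : s ∈ powIdeal k V q)
    (x : SymmetricAlgebra k V ⊗[k] W) :
    ((mk q).restrictScalars k ∘ₗ diagRep ρ g) (s • x) = 0 := by
  change mk q (diagRep ρ g (s • x)) = 0
  rw [isSemilinear_diagRep ρ]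
  exact mk_smul_of_mem (symAct_mem_powIdeal _ hs) _

variable (q)

/-- The representation of `G` on the fiber. -/
def rep : Representation k G (PowFiber k V W q) where
  toFun g := lift ((mk q).restrictScalars k ∘ₗ diagRep ρ g) (lift_hypothesis ρ g)
  map_one' := LinearMap.ext fun y => by
    obtain ⟨x, rfl⟩ := mk_surjective q y
    change mk q (diagRep ρ 1 x) = mk q x
    rw [map_one]
    rfl
  map_mul' g h := LinearMap.ext fun y => by
    obtain ⟨x, rfl⟩ := mk_surjective q y
    change mk q (diagRep ρ (g * h) x) = mk q (diagRep ρ g (diagRep ρ h x))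
    rw [map_mul]
    rfl

@[simp]
theorem rep_mk (g : G) (x : SymmetricAlgebra k V ⊗[k] W) :
    rep ρ q g (mk q x) = mk q (diagRep ρ g x) := rfl

theorem isSemilinear_rep : IsSemilinear (SymmetricAlgebra k V) (rep ρ q) := by
  intro g s y
  obtain ⟨x, rfl⟩ := mk_surjective q y
  rw [← map_smul, rep_mk, isSemilinear_diagRep ρ, map_smul, rep_mk]

end PowFiber

end Fiber

/-! ### Frobenius push-forwards of modules and representations -/

section FrobPush

variable {A : Type*} [CommRing A] {p e : ℕ} [ExpChar A p] {M : Type*} [AddCommGroup M] [Module A M]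

/-- The identity map from a module to its Frobenius push-forward. -/
def toFrob (p e : ℕ) (M : Type*) [AddCommGroup M] : M ≃+ FrobPush p e M := AddEquiv.refl M

theorem smul_toFrob (r : A) (x : M) : r • toFrob p e M x = toFrob p e M (r ^ p ^ e • x) := by
  rw [← iterateFrobenius_def]
  rfl

/-- The Frobenius push-forward of a representation. -/
def frobRep {k : Type*} [Field k] (p e : ℕ) [ExpChar k p] {G : Type*} [Group G]
    {Y : Type*} [AddCommGroup Y] [Module k Y] (π : Representation k G Y) :
    Representation k G (FrobPush p e Y) where
  toFun g :=
    { toFun := fun y => toFrob p e Y (π g ((toFrob p e Y).symm y))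
      map_add' := fun x y => by rw [map_add, map_add, map_add]
      map_smul' := fun c y => by
        obtain ⟨x, rfl⟩ := (toFrob p e Y).surjective y
        rw [smul_toFrob, AddEquiv.symm_apply_apply, AddEquiv.symm_apply_apply, map_smul,
          RingHom.id_apply, smul_toFrob] }
  map_one' := by rw [map_one]; rfl
  map_mul' g h := by rw [map_mul]; rfl

@[simp]
theorem frobRep_toFrob {k : Type*} [Field k] [ExpChar k p] {G : Type*} [Group G]
    {Y : Type*} [AddCommGroup Y] [Module k Y] (π : Representation k G Y) (g : G) (y : Y) :
    frobRep p e π g (toFrob p e Y y) = toFrob p e Y (π g y) := rfl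

/-- The Frobenius of a perfect field is bijective, so twisting the scalars by it preserves
dimensions. -/
theorem finrank_frobPush {k : Type*} [Field k] [ExpChar k p] [PerfectRing k p]
    (Y : Type*) [AddCommGroup Y] [Module k Y] :
    Module.finrank k (FrobPush p e Y) = Module.finrank k Y := by
  refine congrArg Cardinal.toNat (rank_eq_of_equiv_equiv (iterateFrobenius k p e)
    (toFrob p e Y).symm (bijective_iterateFrobenius k p e) fun r y => ?_)
  rfl

theorem finite_frobPush {k : Type*} [Field k] [ExpChar k p] [PerfectRing k p]
    (Y : Type*) [AddCommGroup Y] [Module k Y] [FiniteDimensional k Y] :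
    FiniteDimensional k (FrobPush p e Y) := by
  rw [FiniteDimensional, ← Module.rank_lt_aleph0_iff]
  refine lt_of_eq_of_lt (rank_eq_of_equiv_equiv (iterateFrobenius k p e)
    (toFrob p e Y).symm (bijective_iterateFrobenius k p e) fun r y => ?_)
    (Module.rank_lt_aleph0 k Y)
  rfl

end FrobPush

/-! ### The averaged monomial projection -/

section Average

variable {k : Type*} [Field k] {V : Type*} [AddCommGroup V] [Module k V]
  {G : Subgroup (LinearMap.GeneralLinearGroup k V)} [Fintype G]
  {W : Type*} [AddCommGroup W] [Module k W] (ρ : Representation k G W)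
  {κ : Type*} (b : Module.Basis κ k V) (q : ℕ)

/-- The average over `G` of the projections to the monomials with exponents less than `q`. -/
def boxAverage : SymmetricAlgebra k V ⊗[k] W →ₗ[k] SymmetricAlgebra k V ⊗[k] W :=
  (Nat.card G : k)⁻¹ • ∑ g : G, diagRep ρ g ∘ₗ (boxProj b q).rTensor W ∘ₗ diagRep ρ g⁻¹

theorem boxAverage_apply (x : SymmetricAlgebra k V ⊗[k] W) :
    boxAverage ρ b q x = (Nat.card G : k)⁻¹ •
      ∑ g : G, diagRep ρ g ((boxProj b q).rTensor W (diagRep ρ g⁻¹ x)) := by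
  simp [boxAverage, LinearMap.sum_apply]

theorem boxAverage_diagRep (h : G) (x : SymmetricAlgebra k V ⊗[k] W) :
    boxAverage ρ b q (diagRep ρ h x) = diagRep ρ h (boxAverage ρ b q x) := by
  rw [boxAverage_apply, boxAverage_apply, map_smul, map_sum]
  congr 1
  refine (Fintype.sum_bijective (h * ·) (Group.mulLeft_bijective h) _ _ fun g => ?_).symm
  rw [← Module.End.mul_apply, ← Module.End.mul_apply (diagRep ρ _) (diagRep ρ h), ← map_mul,
    ← map_mul, mul_inv_rev, inv_mul_cancel_right]

/-- The monomial projection kills the ideal of powers and this ideal is stable under `G`, so the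
average descends to the fiber. -/
theorem boxAverage_smul_of_mem (p e : ℕ) [ExpChar k p] {s : SymmetricAlgebra k V}
    (hs : s ∈ powIdeal k V (p ^ e)) (x : SymmetricAlgebra k V ⊗[k] W) :
    boxAverage ρ b (p ^ e) (s • x) = 0 := by
  have key : ∀ t ∈ powIdeal k V (p ^ e), ∀ y : SymmetricAlgebra k V ⊗[k] W,
      (boxProj b (p ^ e)).rTensor W (t • y) = 0 := by
    intro t ht y
    induction y with
    | zero => simp
    | add x y hx hy => rw [smul_add, map_add, hx, hy, add_zero]
    | tmul r w =>
      rw [TensorProduct.smul_tmul', LinearMap.rTensor_tmul, smul_eq_mul,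
        boxProj_eq_zero b p e (Ideal.mul_mem_right _ _ ht), TensorProduct.zero_tmul]
  rw [boxAverage_apply, Finset.sum_eq_zero, smul_zero]
  intro g _
  rw [isSemilinear_diagRep ρ, key (g⁻¹ • s) (symAct_mem_powIdeal _ hs), map_zero]

/-- The error of the average is built from monomials having some exponent at least `q`; this feeds
the induction on degree in `mem_closure_boxAverage`. -/
theorem sub_boxAverage (hcard : (Nat.card G : k) ≠ 0) (s : SymmetricAlgebra k V) (w : W) :
    s ⊗ₜ w - boxAverage ρ b q (s ⊗ₜ w) = (Nat.card G : k)⁻¹ •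
      ∑ g : G, diagRep ρ g ((g⁻¹ • s - boxProj b q (g⁻¹ • s)) ⊗ₜ ρ g⁻¹ w) := by
  have h1 : (s ⊗ₜ w : SymmetricAlgebra k V ⊗[k] W) =
      (Nat.card G : k)⁻¹ • ∑ g : G, diagRep ρ g (diagRep ρ g⁻¹ (s ⊗ₜ w)) := by
    simp only [Representation.self_inv_apply, Finset.sum_const, Finset.card_univ,
      ← Nat.card_eq_fintype_card]
    rw [← Nat.cast_smul_eq_nsmul k, smul_smul, inv_mul_cancel₀ hcard, one_smul]
  refine (congrArg (· - boxAverage ρ b q (s ⊗ₜ w)) h1).trans ?_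
  rw [boxAverage_apply]
  refine (smul_sub _ _ _).symm.trans (congrArg _ ?_)
  refine (Finset.sum_sub_distrib _ _).symm.trans (Finset.sum_congr rfl fun g _ => ?_)
  rw [← map_sub, diagRep_tmul, LinearMap.rTensor_tmul, TensorProduct.sub_tmul]

/-- The multiples by `q`-th powers of elements in the image of the average span everything. -/
theorem mem_closure_boxAverage (p e : ℕ) [ExpChar k p] [PerfectRing k p]
    (hcard : (Nat.card G : k) ≠ 0) (x : SymmetricAlgebra k V ⊗[k] W) :
    x ∈ AddSubgroup.closure {y | ∃ (s : SymmetricAlgebra k V) (z : SymmetricAlgebra k V ⊗[k] W),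
      y = s ^ p ^ e • boxAverage ρ b (p ^ e) z} := by
  set T := AddSubgroup.closure {y | ∃ (s : SymmetricAlgebra k V)
    (z : SymmetricAlgebra k V ⊗[k] W), y = s ^ p ^ e • boxAverage ρ b (p ^ e) z} with hT
  have hq : 0 < p ^ e := pow_pos (expChar_pos k p) e
  have hsmul : ∀ (t : SymmetricAlgebra k V), ∀ y ∈ T, t ^ p ^ e • y ∈ T := by
    intro t y hy
    induction hy using AddSubgroup.closure_induction with
    | mem y hy =>
      obtain ⟨s, z, rfl⟩ := hy
      exact AddSubgroup.subset_closure ⟨t * s, z, by rw [mul_pow, smul_smul]⟩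
    | zero => rw [smul_zero]; exact zero_mem _
    | add y z _ _ hy hz => rw [smul_add]; exact add_mem hy hz
    | neg y _ hy => rw [smul_neg]; exact neg_mem hy
  -- Scalars of a perfect field are themselves `p ^ e`-th powers.
  have hk : ∀ (c : k), ∀ y ∈ T, c • y ∈ T := by
    intro c y hy
    obtain ⟨c', rfl⟩ := (bijective_iterateFrobenius k p e).2 c
    rw [iterateFrobenius_def, ← algebraMap_smul (SymmetricAlgebra k V), map_pow]
    exact hsmul _ _ hy
  -- A graded Nakayama argument. A monomial missed by the projection is `x_i ^ q` times a monomial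
  -- whose degree is lower by `q`, and a group element carries it to a `q`-th power times an element
  -- of that lower degree.
  have main : ∀ n, ∀ s ∈ degreeLE b n, ∀ w : W, s ⊗ₜ w ∈ T := by
    intro n
    induction n using Nat.strong_induction_on with
    | _ n ih =>
      have key : ∀ s ∈ degreeLE b n, ∀ (g : G) (w : W),
          diagRep ρ g ((s - boxProj b (p ^ e) s) ⊗ₜ w) ∈ T := by
        intro s hs g w
        induction hs using Submodule.span_induction with
        | zero => simp
        | add x y _ _ hx hy =>
          rw [map_add, add_sub_add_comm, TensorProduct.add_tmul, map_add]
          exact add_mem hx hy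
        | smul c x _ hx =>
          rw [map_smul, ← smul_sub, ← TensorProduct.smul_tmul', map_smul]
          exact hk _ _ hx
        | mem x hx =>
          obtain ⟨m, hm, rfl⟩ := hx
          by_cases h : ∀ i, m i < p ^ e
          · rw [boxProj_of_forall b h, sub_self, TensorProduct.zero_tmul, map_zero]
            exact zero_mem _
          · push Not at h
            obtain ⟨i, hi⟩ := h
            rw [boxProj_of_le b hi, sub_zero, basis_eq_of_le b hi, ← smul_eq_mul,
              ← TensorProduct.smul_tmul', isSemilinear_diagRep ρ, smul_pow']
            refine hsmul _ _ ?_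
            rw [diagRep_tmul]
            have hdeg : (m - Finsupp.single i (p ^ e)).degree + p ^ e = m.degree := by
              conv_rhs => rw [← tsub_add_cancel_of_le (Finsupp.single_le_iff.2 hi)]
              rw [map_add, Finsupp.degree_single]
            rw [Set.mem_ofPred_eq] at hm
            exact ih (m - Finsupp.single i (p ^ e)).degree (by omega) _
              (symAct_basis_mem_degreeLE b _ _) _
      intro s hs w
      rw [← sub_add_cancel (s ⊗ₜ w) (boxAverage ρ b (p ^ e) (s ⊗ₜ w)), sub_boxAverage ρ b _ hcard]
      refine add_mem (hk _ _ (sum_mem fun g _ => ?_)) (AddSubgroup.subset_closure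
        ⟨1, s ⊗ₜ w, by rw [one_pow, one_smul]⟩)
      exact key _ (symAct_mem_degreeLE b _ hs) g _
  induction x with
  | zero => exact zero_mem _
  | add x y hx hy => exact add_mem hx hy
  | tmul s w =>
    obtain ⟨n, hn⟩ := exists_mem_degreeLE b s
    exact main n s hn w

end Average

end GenFSig

namespace GenFSig

/-- A nonzero element of the kernel, joined to lifts of the `x i`, would be an independent family
larger than the rank of `F`. -/
theorem injective_of_surjective_of_linearIndependent {S F X : Type*} [CommRing S] [IsDomain S]
    [AddCommGroup F] [Module S F] [Module.Free S F] [Module.Finite S F] [AddCommGroup X]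
    [Module S X] (f : F →ₗ[S] X) (hf : Function.Surjective f) {β : Type*} [Fintype β]
    (x : β → X) (hx : LinearIndependent S x) (hle : Module.finrank S F ≤ Fintype.card β) :
    Function.Injective f := by
  rw [injective_iff_map_eq_zero]
  intro z hz
  by_contra hz0
  choose y hy using fun i => hf (x i)
  have hy' : LinearIndependent S y := by
    refine LinearIndependent.of_comp f ?_
    convert hx using 1
    exact funext hy
  have hli : LinearIndependent S (fun o : Option β => o.elim z y) := by
    rw [Fintype.linearIndependent_iff]
    intro c hc
    rw [Fintype.sum_option] at hc
    have h1 := congrArg f hc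
    simp only [Option.elim, map_add, map_smul, map_sum, hz, smul_zero, zero_add, map_zero, hy] at h1
    have h2 := Fintype.linearIndependent_iff.1 hx _ h1
    simp only [Option.elim, h2, zero_smul, Finset.sum_const_zero, add_zero] at hc
    intro o
    cases o with
    | none => exact (smul_eq_zero.1 hc).resolve_right hz0
    | some i => exact h2 i
  have := hli.fintype_card_le_finrank
  rw [Fintype.card_option] at this
  omega

instance instIsScalarTowerFrobPush {A B M : Type*} [CommRing A] [CommRing B] [Algebra A B]
    [AddCommGroup M] [Module A M] [Module B M] [IsScalarTower A B M] (p e : ℕ) [ExpChar A p]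
    [ExpChar B p] : IsScalarTower A B (FrobPush p e M) where
  smul_assoc a b x := by
    obtain ⟨x, rfl⟩ := (toFrob p e M).surjective x
    rw [smul_toFrob, smul_toFrob, smul_toFrob, smul_pow, smul_assoc]

/-! ### Spanning sets of monomials in the fiber -/

section Spanning

variable {k : Type*} [Field k] {V : Type*} [AddCommGroup V] [Module k V]
  {W : Type*} [AddCommGroup W] [Module k W] [FiniteDimensional k W]
  {κ : Type*} (b : Module.Basis κ k V) (q : ℕ)

/-- A finite set of monomials spanning the symmetric algebra modulo the `q`-th powers and a
subspace. -/
theorem exists_finrank_le_of_span (Std : Finset (κ →₀ ℕ)) (P : Submodule k (PowFiber k V W q))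
    (h : ∀ s : SymmetricAlgebra k V, ∃ s₀ ∈ Submodule.span k (b.symmetricAlgebra '' Std), ∀ w : W,
      PowFiber.mk q ((s - s₀) ⊗ₜ w) ∈ P) :
    ∃ Q : Submodule k (PowFiber k V W q), P ⊔ Q = ⊤ ∧ FiniteDimensional k Q ∧
      Module.finrank k Q ≤ Std.card * Module.finrank k W := by
  let c := Module.finBasis k W
  let y : Std × Fin (Module.finrank k W) → PowFiber k V W q := fun x =>
    PowFiber.mk q (b.symmetricAlgebra x.1.1 ⊗ₜ c x.2)
  refine ⟨Submodule.span k (Set.range y), ?_, FiniteDimensional.span_of_finite k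
    (Set.finite_range y), (finrank_range_le_card y).trans (by simp)⟩
  rw [eq_top_iff]
  rintro z -
  obtain ⟨x, rfl⟩ := PowFiber.mk_surjective q z
  induction x with
  | zero => rw [map_zero]; exact zero_mem _
  | add x x' hx hx' => rw [map_add]; exact add_mem hx hx'
  | tmul s w =>
    obtain ⟨s₀, hs₀, hP⟩ := h s
    rw [← sub_add_cancel s s₀, TensorProduct.add_tmul, map_add]
    refine Submodule.add_mem_sup (hP w) ?_
    clear hP
    induction hs₀ using Submodule.span_induction with
    | zero => rw [TensorProduct.zero_tmul, map_zero]; exact zero_mem _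
    | add x x' _ _ hx hx' => rw [TensorProduct.add_tmul, map_add]; exact add_mem hx hx'
    | smul a x _ hx =>
      rw [← TensorProduct.smul_tmul', PowFiber.mk_smul_of_tower]
      exact Submodule.smul_mem _ _ hx
    | mem x hx =>
      obtain ⟨m, hm, rfl⟩ := hx
      have hw := c.mem_span w
      induction hw using Submodule.span_induction with
      | zero => rw [TensorProduct.tmul_zero, map_zero]; exact zero_mem _
      | add w w' _ _ hw hw' => rw [TensorProduct.tmul_add, map_add]; exact add_mem hw hw'
      | smul a w _ hw =>
        rw [TensorProduct.tmul_smul, PowFiber.mk_smul_of_tower]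
        exact Submodule.smul_mem _ _ hw
      | mem w hw =>
        obtain ⟨j, rfl⟩ := hw
        exact Submodule.subset_span ⟨(⟨m, hm⟩, j), rfl⟩

variable [Fintype κ]

/-- The exponents of the monomials with all exponents less than `q`. -/
def boxExp (κ : Type*) [Fintype κ] {q : ℕ} (a : κ → Fin q) : κ →₀ ℕ :=
  Finsupp.equivFunOnFinite.symm fun i => a i

theorem boxExp_injective {q : ℕ} : Function.Injective (boxExp κ : (κ → Fin q) → κ →₀ ℕ) :=
  fun _ _ h => funext fun i => Fin.ext (DFunLike.congr_fun h i)

theorem boxProj_mem_span [DecidableEq κ] (s : SymmetricAlgebra k V) : boxProj b q s ∈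
    Submodule.span k (b.symmetricAlgebra ''
      (Finset.univ.map ⟨boxExp κ, boxExp_injective (q := q)⟩ : Finset (κ →₀ ℕ))) := by
  induction s using symmetricAlgebra_basis_induction b with
  | zero => rw [map_zero]; exact zero_mem _
  | add x y hx hy => rw [map_add]; exact add_mem hx hy
  | smul c x hx => rw [map_smul]; exact Submodule.smul_mem _ _ hx
  | mem m =>
    by_cases h : ∀ i, m i < q
    · rw [boxProj_of_forall b h]
      refine Submodule.subset_span ⟨m, ?_, rfl⟩
      simp only [Finset.coe_map, Function.Embedding.coeFn_mk, Finset.coe_univ, Set.image_univ]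
      exact ⟨fun i => ⟨m i, h i⟩, Finsupp.ext fun i => rfl⟩
    · push Not at h
      obtain ⟨i, hi⟩ := h
      rw [boxProj_of_le b hi]
      exact zero_mem _

/-- The monomials with exponents below `q` span the fiber for every `q`. Equality, for `q = p ^ e`,
is `finrank_powFiber`. -/
theorem finrank_powFiber_le [FiniteDimensional k V] : FiniteDimensional k (PowFiber k V W q) ∧
    Module.finrank k (PowFiber k V W q) ≤ q ^ Module.finrank k V * Module.finrank k W := by
  let b := Module.finBasis k V
  obtain ⟨Q, hQ, hfd, hle⟩ := exists_finrank_le_of_span (W := W) b q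
    (Finset.univ.map ⟨boxExp (Fin _), boxExp_injective (q := q)⟩) ⊥ fun s =>
      ⟨boxProj b q s, boxProj_mem_span b q s, fun w => by
        rw [Submodule.mem_bot, ← mul_one (s - _), ← smul_eq_mul, ← TensorProduct.smul_tmul']
        exact PowFiber.mk_smul_of_mem (sub_boxProj_mem b q s) _⟩
  rw [bot_sup_eq] at hQ
  subst hQ
  rw [finrank_top] at hle
  refine ⟨Module.Finite.equiv (Submodule.topEquiv (R := k)), ?_⟩
  simpa using hle

end Spanning

/-! ### Trivialization of the Frobenius push-forward of `S ⊗ W` -/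

section FrobeniusFree

variable {k : Type*} [Field k] {V : Type*} [AddCommGroup V] [Module k V]
  {G : Subgroup (LinearMap.GeneralLinearGroup k V)} [Fintype G]
  {W : Type*} [AddCommGroup W] [Module k W] (ρ : Representation k G W)
  {κ : Type*} (b : Module.Basis κ k V) (p e : ℕ) [ExpChar k p]

/-- The equivariant section of the projection from the Frobenius push-forward to its fiber. -/
def frobSection : FrobPush p e (PowFiber k V W (p ^ e)) →ₗ[k]
    FrobPush p e (SymmetricAlgebra k V ⊗[k] W) where
  toFun y := toFrob p e _ (PowFiber.lift (boxAverage ρ b (p ^ e))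
    (fun _ hs x => boxAverage_smul_of_mem ρ b p e hs x) ((toFrob p e _).symm y))
  map_add' x y := by rw [map_add, map_add, map_add]
  map_smul' c y := by
    obtain ⟨x, rfl⟩ := (toFrob p e _).surjective y
    rw [smul_toFrob, AddEquiv.symm_apply_apply, AddEquiv.symm_apply_apply, map_smul,
      RingHom.id_apply, smul_toFrob]

theorem frobSection_mk (x : SymmetricAlgebra k V ⊗[k] W) :
    frobSection ρ b p e (toFrob p e _ (PowFiber.mk _ x)) =
      toFrob p e _ (boxAverage ρ b (p ^ e) x) := rfl

/-- The trivialization of the Frobenius push-forward of `S ⊗ W`. -/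
def frobTriv : SymmetricAlgebra k V ⊗[k] FrobPush p e (PowFiber k V W (p ^ e))
    →ₗ[SymmetricAlgebra k V] FrobPush p e (SymmetricAlgebra k V ⊗[k] W) :=
  (frobSection ρ b p e).liftBaseChange (SymmetricAlgebra k V)

theorem frobTriv_tmul (s : SymmetricAlgebra k V) (x : SymmetricAlgebra k V ⊗[k] W) :
    frobTriv ρ b p e (s ⊗ₜ toFrob p e _ (PowFiber.mk _ x)) =
      toFrob p e _ (s ^ p ^ e • boxAverage ρ b (p ^ e) x) := by
  rw [frobTriv, LinearMap.liftBaseChange_tmul, frobSection_mk, smul_toFrob]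

theorem frobTriv_diagRep (g : G)
    (z : SymmetricAlgebra k V ⊗[k] FrobPush p e (PowFiber k V W (p ^ e))) :
    frobTriv ρ b p e (diagRep (frobRep p e (PowFiber.rep ρ (p ^ e))) g z) =
      frobRep p e (diagRep ρ) g (frobTriv ρ b p e z) := by
  induction z with
  | zero => simp only [map_zero]
  | add x y hx hy => simp only [map_add, hx, hy]
  | tmul s y =>
    obtain ⟨y, rfl⟩ := (toFrob p e _).surjective y
    obtain ⟨x, rfl⟩ := PowFiber.mk_surjective _ y
    rw [diagRep_tmul, frobRep_toFrob, PowFiber.rep_mk, frobTriv_tmul, frobTriv_tmul,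
      frobRep_toFrob, isSemilinear_diagRep ρ, boxAverage_diagRep, smul_pow']

theorem frobTriv_surjective [PerfectRing k p] (hcard : (Nat.card G : k) ≠ 0) :
    Function.Surjective (frobTriv ρ b p e) := by
  intro y
  obtain ⟨y, rfl⟩ := (toFrob p e _).surjective y
  have hy := mem_closure_boxAverage ρ b p e hcard y
  induction hy using AddSubgroup.closure_induction with
  | mem y hy =>
    obtain ⟨s, z, rfl⟩ := hy
    exact ⟨_, frobTriv_tmul ρ b p e s z⟩
  | zero => exact ⟨0, by rw [map_zero, map_zero]⟩
  | add y z _ _ hy hz =>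
    obtain ⟨y', hy⟩ := hy
    obtain ⟨z', hz⟩ := hz
    exact ⟨y' + z', by rw [map_add, hy, hz, map_add]⟩
  | neg y _ hy =>
    obtain ⟨y', hy⟩ := hy
    exact ⟨-y', by rw [map_neg, hy, map_neg]⟩

variable [Fintype κ] [DecidableEq κ] [FiniteDimensional k W]

/-- Coordinates along a basis of `W` reduce this to the independence of the box monomials over `p ^
e`-th powers. -/
theorem linearIndependent_frobPush :
    LinearIndependent (SymmetricAlgebra k V)
      fun x : (κ → Fin (p ^ e)) × Fin (Module.finrank k W) =>
        toFrob p e (SymmetricAlgebra k V ⊗[k] W)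
          (b.symmetricAlgebra (boxExp κ x.1) ⊗ₜ Module.finBasis k W x.2) := by
  let B := (Module.finBasis k W).baseChange (SymmetricAlgebra k V)
  rw [Fintype.linearIndependent_iff]
  intro c hc
  have h1 : ∑ x : (κ → Fin (p ^ e)) × Fin (Module.finrank k W),
      (c x ^ p ^ e * b.symmetricAlgebra (boxExp κ x.1)) • B x.2 = 0 := by
    apply (toFrob p e (SymmetricAlgebra k V ⊗[k] W)).injective
    rw [map_sum, map_zero, ← hc]
    refine Finset.sum_congr rfl fun x _ => ?_
    rw [smul_toFrob, Module.Basis.baseChange_apply, TensorProduct.smul_tmul',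
      TensorProduct.smul_tmul', smul_eq_mul, smul_eq_mul, mul_one]
  rintro ⟨a, j⟩
  rw [Fintype.sum_prod_type_right] at h1
  simp only [← Finset.sum_smul] at h1
  have h2 := Fintype.linearIndependent_iff.1 B.linearIndependent _ h1 j
  exact eq_zero_of_sum_pow_mul_basis b p e Finset.univ (boxExp κ) boxExp_injective
    (fun a i => (a i).2) (fun a => c (a, j)) h2 a (Finset.mem_univ a)

/-- The source is free of rank at most `(p ^ e) ^ d * dim W`, while the target contains that many
independent elements, so a surjection has no kernel. -/
theorem frobTriv_bijective [FiniteDimensional k V] [PerfectRing k p] (hcard : (Nat.card G : k) ≠ 0) :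
    Function.Bijective (frobTriv ρ b p e) := by
  have hsurj := frobTriv_surjective ρ b p e hcard
  refine ⟨?_, hsurj⟩
  obtain ⟨hfd, hle⟩ := finrank_powFiber_le (k := k) (V := V) (W := W) (p ^ e)
  have := finite_frobPush (k := k) (p := p) (e := e) (PowFiber k V W (p ^ e))
  refine injective_of_surjective_of_linearIndependent _ hsurj _
    (linearIndependent_frobPush b p e) ?_
  rw [Module.finrank_baseChange, finrank_frobPush]
  simpa [Module.finrank_eq_card_basis b] using hle

/-- The independent family of `linearIndependent_frobPush` pulls back along the trivialization,
which bounds the rank of the source from below. -/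
theorem finrank_powFiber [FiniteDimensional k V] [PerfectRing k p] (ρ : Representation k G W)
    (hcard : (Nat.card G : k) ≠ 0) :
    Module.finrank k (PowFiber k V W (p ^ e)) =
      (p ^ e) ^ Module.finrank k V * Module.finrank k W := by
  let b := Module.finBasis k V
  obtain ⟨hfd, hle⟩ := finrank_powFiber_le (k := k) (V := V) (W := W) (p ^ e)
  refine le_antisymm hle ?_
  have := finite_frobPush (k := k) (p := p) (e := e) (PowFiber k V W (p ^ e))
  let E := LinearEquiv.ofBijective _ (frobTriv_bijective ρ b p e hcard)
  have h := ((linearIndependent_frobPush (W := W) b p e).map' E.symm.toLinearMap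
    E.symm.ker).fintype_card_le_finrank
  rw [Module.finrank_baseChange, finrank_frobPush] at h
  simpa using h

/-- The Frobenius push-forward of a module of covariants is a module of covariants. -/
theorem nonempty_covariants_equiv_frobPush [FiniteDimensional k V] [PerfectRing k p]
    (hcard : (Nat.card G : k) ≠ 0) :
    Nonempty (FrobPush p e (covariants G ρ) ≃ₗ[invariantRing G]
      covariants G (frobRep p e (PowFiber.rep ρ (p ^ e)))) := by
  let b := Module.finBasis k V
  -- Equivariance lets the trivialization restrict to invariants, on which linearity over `S` leaves
  -- linearity over the invariant ring.
  let ψ₀ : covariants G (frobRep p e (PowFiber.rep ρ (p ^ e))) →+ covariants G ρ :=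
    { toFun := fun z => ⟨(toFrob p e _).symm (frobTriv ρ b p e z.1), fun g => by
        have h := frobTriv_diagRep ρ b p e g z.1
        rw [show diagRep _ g z.1 = z.1 from z.2 g] at h
        exact congrArg (toFrob p e _).symm h.symm⟩
      map_zero' := Subtype.ext (by
        change (toFrob p e _).symm (frobTriv ρ b p e 0) = 0
        rw [map_zero, map_zero])
      map_add' := fun x y => Subtype.ext (by
        change (toFrob p e _).symm (frobTriv ρ b p e (x.1 + y.1)) =
          (toFrob p e _).symm (frobTriv ρ b p e x.1) + (toFrob p e _).symm (frobTriv ρ b p e y.1)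
        rw [map_add, map_add]) }
  have hψ₀ : ∀ z, toFrob p e (SymmetricAlgebra k V ⊗[k] W) (ψ₀ z).1 = frobTriv ρ b p e z.1 :=
    fun z => AddEquiv.apply_symm_apply _ _
  let ψ : covariants G (frobRep p e (PowFiber.rep ρ (p ^ e))) →ₗ[invariantRing G]
      FrobPush p e (covariants G ρ) :=
    { toFun := fun z => toFrob p e _ (ψ₀ z)
      map_add' := fun x y => by rw [map_add, map_add]
      map_smul' := fun r x => by
        rw [RingHom.id_apply, smul_toFrob]
        refine congrArg (toFrob p e (covariants G ρ)) (Subtype.ext ?_)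
        apply (toFrob p e (SymmetricAlgebra k V ⊗[k] W)).injective
        rw [hψ₀]
        refine ((frobTriv ρ b p e).map_smul (r : SymmetricAlgebra k V) x.1).trans ?_
        rw [← hψ₀, smul_toFrob]
        rfl }
  have hbij := frobTriv_bijective ρ b p e hcard
  refine ⟨(LinearEquiv.ofBijective ψ ⟨fun x y h => ?_, fun y => ?_⟩).symm⟩
  · apply Subtype.ext
    apply hbij.1
    rw [← hψ₀, ← hψ₀, (toFrob p e (covariants G ρ)).injective h]
  · obtain ⟨y, rfl⟩ := (toFrob p e _).surjective y
    obtain ⟨z, hz⟩ := hbij.2 (toFrob p e _ y.1)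
    refine ⟨⟨z, fun g => ?_⟩, ?_⟩
    · apply hbij.1
      refine (frobTriv_diagRep ρ b p e g z).trans ?_
      rw [hz, frobRep_toFrob]
      exact congrArg _ (y.2 g)
    · refine congrArg (toFrob p e (covariants G ρ)) (Subtype.ext ?_)
      apply (toFrob p e (SymmetricAlgebra k V ⊗[k] W)).injective
      rw [hψ₀, hz]

end FrobeniusFree

end GenFSig

/-! ### Multiplication by a fixed polynomial on the fibers -/

namespace GenFSig

/-- The pair `(x, f)` is recovered after exchanging the coordinate `f i < n` with the arbitrary
value `x < q`. -/
theorem mul_card_filter_lt_le {κ : Type*} [Fintype κ] [DecidableEq κ] (q n : ℕ) (i : κ) :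
    q * (Finset.univ.filter fun f : κ → Fin q => (f i : ℕ) < n).card ≤
      n * q ^ Fintype.card κ := by
  let F : Fin q × {f : κ → Fin q // (f i : ℕ) < n} → Fin n × (κ → Fin q) := fun x =>
    (⟨x.2.1 i, x.2.2⟩, Function.update x.2.1 i x.1)
  have hF : Function.Injective F := by
    rintro ⟨x, f, hf⟩ ⟨y, g, hg⟩ h
    simp only [F, Prod.mk.injEq, Fin.mk.injEq] at h
    obtain ⟨h1, h2⟩ := h
    have hxy : x = y := by simpa using congrFun h2 i
    have hfg : f = g := by
      funext j
      by_cases hj : j = i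
      · rw [hj]; exact Fin.ext h1
      · simpa [hj] using congrFun h2 j
    subst hxy hfg
    rfl
  have := Fintype.card_le_of_injective F hF
  simpa [Fintype.card_subtype] using this

section Standard

variable {k : Type*} [Field k] {V : Type*} [AddCommGroup V] [Module k V]
  {W : Type*} [AddCommGroup W] [Module k W] {κ : Type*} [Fintype κ] [DecidableEq κ]

/-- The exponents less than `q` which are not multiples of `a`. -/
def standardExp (a : κ →₀ ℕ) (q : ℕ) : Finset (κ →₀ ℕ) :=
  (Finset.univ.filter fun f : κ → Fin q => ∃ i, (f i : ℕ) < a i).map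
    ⟨boxExp κ, boxExp_injective⟩

theorem mem_standardExp {a c : κ →₀ ℕ} {q : ℕ} (h : ∀ i, c i < q) (hc : ¬ a ≤ c) :
    c ∈ standardExp a q := by
  rw [standardExp, Finset.mem_map]
  refine ⟨fun i => ⟨c i, h i⟩, ?_, Finsupp.ext fun i => rfl⟩
  rw [Finsupp.le_def] at hc
  push Not at hc
  simpa using hc

/-- A union bound over the coordinate where `a` is not reached. The count has one power of `q` less
than the whole box. -/
theorem mul_card_standardExp_le (a : κ →₀ ℕ) (q : ℕ) :
    q * (standardExp a q).card ≤ (∑ i, a i) * q ^ Fintype.card κ := by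
  rw [standardExp, Finset.card_map]
  have h : (Finset.univ.filter fun f : κ → Fin q => ∃ i, (f i : ℕ) < a i) ⊆
      Finset.univ.biUnion fun i => Finset.univ.filter fun f : κ → Fin q => (f i : ℕ) < a i := by
    intro f hf
    simpa using hf
  calc _ ≤ q * ∑ i, (Finset.univ.filter fun f : κ → Fin q => (f i : ℕ) < a i).card :=
        Nat.mul_le_mul_left _ ((Finset.card_le_card h).trans Finset.card_biUnion_le)
    _ ≤ _ := by
        rw [Finset.mul_sum, Finset.sum_mul]
        exact Finset.sum_le_sum fun i _ => mul_card_filter_lt_le q (a i) i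

/-- Modulo the `q`-th powers and a polynomial `D`, the symmetric algebra is spanned by few
monomials. -/
theorem exists_sub_mem_span_standardExp (b : Module.Basis κ k V) {D : SymmetricAlgebra k V}
    (hD : D ≠ 0) : ∃ a : κ →₀ ℕ, ∀ (q : ℕ) (s : SymmetricAlgebra k V),
      ∃ s₀ ∈ Submodule.span k (b.symmetricAlgebra '' (standardExp a q : Finset (κ →₀ ℕ))),
        s - s₀ ∈ Ideal.span {D} ⊔ powIdeal k V q := by
  let φ := SymmetricAlgebra.equivMvPolynomial b
  classical
  let _ : LinearOrder κ := linearOrderOfSTO WellOrderingRel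
  let o : MonomialOrder κ := MonomialOrder.lex
  refine ⟨o.degree (φ D), fun q s => ?_⟩
  -- Division by `D` and the powers `x_i ^ q`: monomials of the remainder are divisible neither by
  -- the leading monomial of `D` nor by any `x_i ^ q`, hence are standard.
  let B : Set (MvPolynomial κ k) :=
    insert (φ D) (Set.range fun i => MvPolynomial.monomial (Finsupp.single i q) 1)
  have hB : ∀ β ∈ B, IsUnit (o.leadingCoeff β) := by
    rintro β (rfl | ⟨i, rfl⟩)
    · rw [isUnit_iff_ne_zero, Ne, MonomialOrder.leadingCoeff_eq_zero_iff]
      simpa using hD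
    · simp
  obtain ⟨g, r, hs, -, hr⟩ := o.div_set hB (φ s)
  refine ⟨φ.symm r, ?_, ?_⟩
  · rw [← r.support_sum_monomial_coeff, map_sum]
    refine Submodule.sum_mem _ fun c hc => ?_
    have : φ.symm (MvPolynomial.monomial c (r.coeff c)) = r.coeff c • b.symmetricAlgebra c := by
      rw [symmetricAlgebra_basis_apply, ← map_smul, MvPolynomial.smul_monomial, smul_eq_mul,
        mul_one]
    rw [this]
    refine Submodule.smul_mem _ _ (Submodule.subset_span ⟨c, ?_, rfl⟩)
    refine mem_standardExp (fun i => ?_) (hr c hc _ (Set.mem_insert _ _))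
    have h := hr c hc _ (Set.mem_insert_of_mem _ ⟨i, rfl⟩)
    rw [o.degree_monomial, if_neg one_ne_zero, Finsupp.single_le_iff] at h
    exact not_le.1 h
  · have h1 : φ (s - φ.symm r) ∈ Ideal.span B := by
      rw [map_sub, AlgEquiv.apply_symm_apply, hs, add_sub_cancel_right,
        Finsupp.linearCombination_apply]
      exact Submodule.sum_mem _ fun β _ => Submodule.smul_mem _ _ (Submodule.subset_span β.2)
    have h2 : Ideal.span B ≤ (Ideal.span {D} ⊔ powIdeal k V q).comap (φ.symm : _ →+* _) := by
      rw [Ideal.span_le]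
      rintro β (rfl | ⟨i, rfl⟩)
      · change φ.symm (φ D) ∈ Ideal.span {D} ⊔ powIdeal k V q
        rw [AlgEquiv.symm_apply_apply]
        exact Ideal.mem_sup_left (Ideal.mem_span_singleton_self D)
      · change φ.symm (MvPolynomial.monomial (Finsupp.single i q) 1) ∈ Ideal.span {D} ⊔ powIdeal k V q
        rw [← symmetricAlgebra_basis_apply, symmetricAlgebra_basis_single]
        exact Ideal.mem_sup_right (ι_pow_mem_powIdeal _ _)
    have h3 := h2 h1
    change φ.symm (φ _) ∈ Ideal.span {D} ⊔ powIdeal k V q at h3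
    rwa [AlgEquiv.symm_apply_apply] at h3

/-- The kernel of multiplication by a nonzero polynomial on the fibers is small. -/
theorem exists_mul_finrank_ker_le [FiniteDimensional k V] {D : SymmetricAlgebra k V} (hD : D ≠ 0) :
    ∃ A : ℕ, ∀ (W : Type w) [AddCommGroup W] [Module k W] [FiniteDimensional k W] (q : ℕ),
      q * Module.finrank k (LinearMap.ker (smulMap k (PowFiber k V W q) D)) ≤
        A * q ^ Module.finrank k V * Module.finrank k W := by
  let b := Module.finBasis k V
  obtain ⟨a, ha⟩ := exists_sub_mem_span_standardExp b hD
  refine ⟨∑ i, a i, fun W _ _ _ q => ?_⟩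
  obtain ⟨hfd, -⟩ := finrank_powFiber_le (k := k) (V := V) (W := W) q
  let f := smulMap k (PowFiber k V W q) D
  obtain ⟨Q, hQ, -, hle⟩ := exists_finrank_le_of_span (W := W) b q (standardExp a q)
    (LinearMap.range f) fun s => by
      obtain ⟨s₀, hs₀, hs⟩ := ha q s
      refine ⟨s₀, hs₀, fun w => ?_⟩
      obtain ⟨y, hy, z, hz, hyz⟩ := Submodule.mem_sup.1 hs
      obtain ⟨t, rfl⟩ := Ideal.mem_span_singleton.1 hy
      rw [← hyz, TensorProduct.add_tmul, map_add]
      refine add_mem ⟨PowFiber.mk q (t ⊗ₜ w), ?_⟩ ?_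
      · rw [smulMap_apply, ← map_smul, TensorProduct.smul_tmul', smul_eq_mul]
      · rw [← mul_one z, ← smul_eq_mul, ← TensorProduct.smul_tmul', PowFiber.mk_smul_of_mem hz]
        exact zero_mem _
  -- On a finite-dimensional space the kernel is as large as the cokernel, and the cokernel is
  -- spanned by the image of `Q`.
  have h1 := LinearMap.finrank_range_add_finrank_ker f
  have h2 := Submodule.finrank_add_le_finrank_add_finrank (LinearMap.range f) Q
  rw [hQ, finrank_top] at h2
  have h3 : Module.finrank k (LinearMap.ker f) ≤ (standardExp a q).card * Module.finrank k W := by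
    omega
  have h4 := mul_card_standardExp_le a q
  rw [Fintype.card_fin] at h4
  calc q * Module.finrank k (LinearMap.ker f)
      ≤ q * ((standardExp a q).card * Module.finrank k W) := Nat.mul_le_mul_left _ h3
    _ = q * (standardExp a q).card * Module.finrank k W := (mul_assoc _ _ _).symm
    _ ≤ _ := Nat.mul_le_mul_right _ h4

end Standard

end GenFSig

namespace GenFSig

/-! ### Decomposition of representations and multiplicities -/

section Representations

variable {k G : Type*} [Field k] [Group G]

/-- The product of a family of representations. -/
def piRep {I : Type*} {N : I → Type*} [∀ i, AddCommGroup (N i)] [∀ i, Module k (N i)]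
    (τ : ∀ i, Representation k G (N i)) : Representation k G (∀ i, N i) where
  toFun g := LinearMap.pi fun i => τ i g ∘ₗ LinearMap.proj i
  map_one' := LinearMap.ext fun x => funext fun i => by simp
  map_mul' g h := LinearMap.ext fun x => funext fun i => by simp

variable {Y : Type*} [AddCommGroup Y] [Module k Y] {Z : Type*} [AddCommGroup Z] [Module k Z]

theorem isIrreducible_of_equiv {σ : Representation k G Y} {τ : Representation k G Z}
    (φ : σ.Equiv τ) (hσ : σ.IsIrreducible) : τ.IsIrreducible := by
  rw [Representation.irreducible_iff_isSimpleModule_asModule] at hσ ⊢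
  let f := Representation.IntertwiningMap.equivLinearMapAsModule σ τ φ.toIntertwiningMap
  have hf : Function.Bijective f := EquivLike.bijective φ
  exact (LinearEquiv.ofBijective f hf).isSimpleModule_iff.1 hσ

/-- A simple module is finitely generated over the group algebra, which is finite-dimensional. -/
theorem finiteDimensional_of_isIrreducible [Finite G] {σ : Representation k G Y}
    (hσ : σ.IsIrreducible) : FiniteDimensional k Y := by
  rw [Representation.irreducible_iff_isSimpleModule_asModule] at hσ
  have h1 : Module.Finite (MonoidAlgebra k G) σ.asModule := inferInstance
  have h2 : Module.Finite k σ.asModule := Module.Finite.trans (MonoidAlgebra k G) _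
  exact Module.Finite.equiv σ.asModuleEquiv

/-- The conjugate of a representation by a linear equivalence. -/
def conjRep (σ : Representation k G Y) (e : Y ≃ₗ[k] Z) : Representation k G Z where
  toFun g := e.toLinearMap ∘ₗ σ g ∘ₗ e.symm.toLinearMap
  map_one' := LinearMap.ext fun x => by simp
  map_mul' g h := LinearMap.ext fun x => by simp

/-- A representation is isomorphic to its conjugate. -/
def conjRepEquiv (σ : Representation k G Y) (e : Y ≃ₗ[k] Z) : σ.Equiv (conjRep σ e) :=
  Representation.Equiv.mk e fun g => LinearMap.ext fun x => by simp [conjRep]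

/-- The representation on a submodule over the group algebra. -/
def submoduleRep (σ : Representation k G Y) (P : Submodule (MonoidAlgebra k G) σ.asModule) :
    Representation k G P where
  toFun g :=
    { toFun := fun x => MonoidAlgebra.of k G g • x
      map_add' := smul_add _
      map_smul' := fun c x => smul_comm _ c x }
  map_one' := LinearMap.ext fun x => by
    change MonoidAlgebra.of k G 1 • x = x
    rw [map_one, one_smul]
  map_mul' g h := LinearMap.ext fun x => by
    change MonoidAlgebra.of k G (g * h) • x = MonoidAlgebra.of k G g • MonoidAlgebra.of k G h • x
    rw [map_mul, mul_smul]

theorem submoduleRep_isIrreducible (σ : Representation k G Y)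
    (P : Submodule (MonoidAlgebra k G) σ.asModule) (hP : IsSimpleModule (MonoidAlgebra k G) P) :
    (submoduleRep σ P).IsIrreducible := by
  rw [Representation.irreducible_iff_isSimpleModule_asModule]
  let ψ : P ≃+ (submoduleRep σ P).asModule := AddEquiv.refl P
  have key : ∀ (r : MonoidAlgebra k G) (x : P), ψ (r • x) = r • ψ x := by
    intro r x
    induction r using MonoidAlgebra.induction_linear with
    | zero => exact (congrArg ψ (zero_smul _ x)).trans ((map_zero ψ).trans (zero_smul _ (ψ x)).symm)
    | add r s hr hs => rw [add_smul, add_smul, map_add, hr, hs]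
    | single g a =>
      rw [Representation.single_smul]
      change MonoidAlgebra.single g a • x = a • (MonoidAlgebra.of k G g • x)
      rw [← smul_assoc]
      simp
  let f : P ≃ₗ[MonoidAlgebra k G] (submoduleRep σ P).asModule :=
    { ψ with map_smul' := key }
  exact f.isSimpleModule_iff.1 hP

/-- The Hom-spaces into a product of representations. -/
def intertwiningPiEquiv {I : Type*} {N : I → Type*} [∀ i, AddCommGroup (N i)]
    [∀ i, Module k (N i)] (τ : ∀ i, Representation k G (N i)) (σ : Representation k G Y) :
    σ.IntertwiningMap (piRep τ) ≃ₗ[k] ∀ i, σ.IntertwiningMap (τ i) where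
  toFun f i := ⟨LinearMap.proj i ∘ₗ f.toLinearMap, fun g => LinearMap.ext fun x =>
    congrFun (Representation.IntertwiningMap.isIntertwining _ _ f g x) i⟩
  invFun f := ⟨LinearMap.pi fun i => (f i).toLinearMap, fun g => LinearMap.ext fun x =>
    funext fun i => Representation.IntertwiningMap.isIntertwining _ _ (f i) g x⟩
  map_add' _ _ := rfl
  map_smul' _ _ := rfl
  left_inv _ := rfl
  right_inv _ := rfl

/-- Composition with an isomorphism of representations. -/
def intertwiningCongr {U : Type*} [AddCommGroup U] [Module k U] (σ : Representation k G U)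
    {τ : Representation k G Y} {τ' : Representation k G Z} (φ : τ.Equiv τ') :
    σ.IntertwiningMap τ ≃ₗ[k] σ.IntertwiningMap τ' where
  toFun f := φ.toIntertwiningMap.comp f
  invFun f := φ.symm.toIntertwiningMap.comp f
  map_add' f f' := by ext x; simp
  map_smul' c f := by ext x; simp
  left_inv f := by ext x; simp
  right_inv f := by ext x; simp

section Multiplicity

variable [IsAlgClosed k] [Finite G] {ι : Type*} [Fintype ι] [DecidableEq ι]
  {W : ι → Type*} [∀ i, AddCommGroup (W i)] [∀ i, Module k (W i)] (ρ : ∀ i, Representation k G (W i))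

/-- The multiplicity of an irreducible representation is the dimension of a Hom-space. -/
theorem finrank_intertwiningMap_piRep (hirr : ∀ i, (ρ i).IsIrreducible)
    (hne : ∀ i j, i ≠ j → IsEmpty ((ρ i).Equiv (ρ j))) (c : ι → ℕ) (j : ι) :
    Module.finrank k ((ρ j).IntertwiningMap (piRep fun s : (Σ i, Fin (c i)) => ρ s.1)) = c j := by
  have hfd := fun i => finiteDimensional_of_isIrreducible (hirr i)
  rw [(intertwiningPiEquiv (fun s : (Σ i, Fin (c i)) => ρ s.1) (ρ j)).finrank_eq,
    Module.finrank_pi_fintype, Fintype.sum_sigma]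
  -- Schur's lemma over an algebraically closed field.
  have h : ∀ i, Module.finrank k ((ρ j).IntertwiningMap (ρ i)) = if i = j then 1 else 0 := by
    intro i
    have := hirr j
    have := hirr i
    split_ifs with hij
    · subst hij
      exact Representation.IsIrreducible.finrank_intertwiningMap_self (ρ i)
    · have := hne j i (Ne.symm hij)
      exact Module.finrank_zero_of_subsingleton
  simp [h]

end Multiplicity

end Representations

/-- Every finite-dimensional representation is a product of the given irreducible ones. -/
theorem exists_equiv_piRep {k : Type u} [Field k] {G : Type*} [Group G] [Finite G]
    [NeZero (Nat.card G : k)] {ι : Type*} [Fintype ι] [DecidableEq ι]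
    {W : ι → Type*} [∀ i, AddCommGroup (W i)] [∀ i, Module k (W i)]
    (ρ : ∀ i, Representation k G (W i))
    (hcomplete : ∀ (U : Type u) [AddCommGroup U] [Module k U] (σ : Representation k G U),
      σ.IsIrreducible → ∃ i, Nonempty (σ.Equiv (ρ i)))
    {Y : Type*} [AddCommGroup Y] [Module k Y] [FiniteDimensional k Y] (σ : Representation k G Y) :
    ∃ c : ι → ℕ, Nonempty (σ.Equiv (piRep fun s : (Σ i, Fin (c i)) => ρ s.1)) := by
  have hfin : Module.Finite (MonoidAlgebra k G) σ.asModule :=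
    Module.Finite.of_restrictScalars_finite k _ _
  obtain ⟨n, S, e, hS⟩ :=
    IsSemisimpleModule.exists_linearEquiv_fin_dfinsupp (MonoidAlgebra k G) σ.asModule
  have hj : ∀ i, ∃ j, Nonempty ((submoduleRep σ (S i)).Equiv (ρ j)) := by
    intro i
    have hirr := submoduleRep_isIrreducible σ (S i) (hS i)
    have := finiteDimensional_of_isIrreducible hirr
    -- Transport to a coordinate space over `k`, which lies in the universe where `hcomplete`
    -- applies.
    let φ := conjRepEquiv (submoduleRep σ (S i)) (Module.finBasis k (S i)).equivFun
    obtain ⟨j, ⟨ψ⟩⟩ := hcomplete _ _ (isIrreducible_of_equiv φ hirr)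
    exact ⟨j, ⟨φ.trans ψ⟩⟩
  choose j hj using hj
  -- `c x` counts the simple summands of type `x`, and `ε` regroups the summands by type.
  let c : ι → ℕ := fun x => Fintype.card {i // j i = x}
  let ε : (Σ x, Fin (c x)) ≃ Fin n :=
    (Equiv.sigmaCongrRight fun x => (Fintype.equivFin {i // j i = x}).symm).trans
      (Equiv.sigmaFiberEquiv j)
  have hε : ∀ s, j (ε s) = s.1 := fun s => ((Fintype.equivFin {i // j i = s.1}).symm s.2).2
  have hφ : ∀ s, Nonempty ((submoduleRep σ (S (ε s))).Equiv (ρ s.1)) := fun s => hε s ▸ hj (ε s)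
  let φ := fun s => (hφ s).some
  let E : Y ≃ₗ[k] (∀ s : (Σ i, Fin (c i)), W s.1) :=
    ((σ.asModuleEquiv.symm.trans (e.restrictScalars k)).trans
      (DFinsupp.linearEquivFunOnFintype (R := k))).trans
      ((LinearEquiv.piCongrLeft' k (fun i => S i) ε.symm).trans
        (LinearEquiv.piCongrRight fun s => (φ s).toLinearEquiv))
  refine ⟨c, ⟨Representation.Equiv.mk E fun g => LinearMap.ext fun y => funext fun s => ?_⟩⟩
  change φ s (e (σ.asModuleEquiv.symm (σ g y)) (ε s)) =
    ρ s.1 g (φ s (e (σ.asModuleEquiv.symm y) (ε s)))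
  rw [Representation.asModuleEquiv_symm_map_rho, map_smul]
  exact Representation.IntertwiningMap.isIntertwining _ _ (φ s).toIntertwiningMap g _

end GenFSig

namespace GenFSig

/-! ### Functoriality of the modules of covariants -/

section CovariantsFunctor

variable {k : Type*} [Field k] {V : Type*} [AddCommGroup V] [Module k V]
  {G : Subgroup (LinearMap.GeneralLinearGroup k V)}
  {U : Type*} [AddCommGroup U] [Module k U] {U' : Type*} [AddCommGroup U'] [Module k U']
  {σ : Representation k G U} {σ' : Representation k G U'}

/-- Isomorphic representations have isomorphic modules of covariants. -/
def covariantsCongr (φ : σ.Equiv σ') : covariants G σ ≃ₗ[invariantRing G] covariants G σ' :=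
  let A : SymmetricAlgebra k V ⊗[k] U ≃ₗ[SymmetricAlgebra k V] SymmetricAlgebra k V ⊗[k] U' :=
    TensorProduct.AlgebraTensorModule.congr (LinearEquiv.refl _ _) φ.toLinearEquiv
  have hA : ∀ g x, A (diagRep σ g x) = diagRep σ' g (A x) := fun g x => by
    induction x with
    | zero => simp
    | add x y hx hy => simp only [map_add, hx, hy]
    | tmul s u =>
      change (g • s) ⊗ₜ φ (σ g u) = (g • s) ⊗ₜ σ' g (φ u)
      exact congrArg _ (Representation.IntertwiningMap.isIntertwining _ _ φ.toIntertwiningMap g u)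
  { toFun := fun x => ⟨A x.1, fun g => (hA g x.1).symm.trans (congrArg A (x.2 g))⟩
    map_add' := fun x y => Subtype.ext (map_add A x.1 y.1)
    map_smul' := fun r x => Subtype.ext (A.map_smul (r : SymmetricAlgebra k V) x.1)
    invFun := fun x => ⟨A.symm x.1, fun g => A.injective ((hA g _).trans (by
      rw [A.apply_symm_apply]; exact x.2 g))⟩
    left_inv := fun x => Subtype.ext (A.symm_apply_apply x.1)
    right_inv := fun x => Subtype.ext (A.apply_symm_apply x.1) }

/-- The module of covariants of a product of representations. -/
def covariantsPiEquiv {I : Type*} [Fintype I] [DecidableEq I] {N : I → Type*}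
    [∀ i, AddCommGroup (N i)] [∀ i, Module k (N i)] (τ : ∀ i, Representation k G (N i)) :
    covariants G (piRep τ) ≃ₗ[invariantRing G] ∀ i, covariants G (τ i) :=
  let A := TensorProduct.piRight k (SymmetricAlgebra k V) (SymmetricAlgebra k V) N
  have hA : ∀ g x i, A (diagRep (piRep τ) g x) i = diagRep (τ i) g (A x i) := fun g x i => by
    induction x with
    | zero => simp
    | add x y hx hy => simp only [map_add, Pi.add_apply, hx, hy]
    | tmul s u => rfl
  { toFun := fun x i => ⟨A x.1 i, fun g => (hA g x.1 i).symm.trans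
      (congrFun (congrArg A (x.2 g)) i)⟩
    map_add' := fun x y => funext fun i => Subtype.ext (congrFun (map_add A x.1 y.1) i)
    map_smul' := fun r x => funext fun i => Subtype.ext
      (congrFun (A.map_smul (r : SymmetricAlgebra k V) x.1) i)
    invFun := fun x => ⟨A.symm fun i => (x i).1, fun g => A.injective (funext fun i =>
      (hA g _ i).trans (by rw [A.apply_symm_apply]; exact (x i).2 g))⟩
    left_inv := fun x => Subtype.ext (A.symm_apply_apply x.1)
    right_inv := fun x => funext fun i =>
      Subtype.ext (congrFun (A.apply_symm_apply fun i => (x i).1) i) }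

/-- The module of covariants of a direct sum of copies of given representations. -/
def covariantsSigmaEquiv {ι : Type*} [Fintype ι] [DecidableEq ι] {W : ι → Type*}
    [∀ i, AddCommGroup (W i)] [∀ i, Module k (W i)] (ρ : ∀ i, Representation k G (W i))
    (c : ι → ℕ) : covariants G (piRep fun s : (Σ i, Fin (c i)) => ρ s.1) ≃ₗ[invariantRing G]
      ((j : ι) → Fin (c j) → covariants G (ρ j)) :=
  (covariantsPiEquiv fun s : (Σ i, Fin (c i)) => ρ s.1).trans
    (LinearEquiv.piCurry (invariantRing G) fun j (_ : Fin (c j)) => covariants G (ρ j))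

/-- The covariants of the trivial representation are the invariants. -/
def covariantsTrivialEquiv :
    covariants G (Representation.trivial k G k) ≃ₗ[invariantRing G] invariantRing G :=
  let A : SymmetricAlgebra k V ⊗[k] k ≃ₗ[SymmetricAlgebra k V] SymmetricAlgebra k V :=
    TensorProduct.AlgebraTensorModule.rid k (SymmetricAlgebra k V) (SymmetricAlgebra k V)
  have hA : ∀ (g : G) x, A (diagRep (Representation.trivial k G k) g x) = g • A x := fun g x => by
    induction x with
    | zero => simp
    | add x y hx hy => simp only [map_add, smul_add, hx, hy]
    | tmul s u =>
      change u • (g • s) = g • (u • s)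
      rw [group_smul_def, group_smul_def, map_smul]
  { toFun := fun x => ⟨A x.1, (mem_invariantRing_iff G).2 fun g =>
      (hA g x.1).symm.trans (congrArg A (x.2 g))⟩
    map_add' := fun x y => Subtype.ext (map_add A x.1 y.1)
    map_smul' := fun r x => Subtype.ext (A.map_smul (r : SymmetricAlgebra k V) x.1)
    invFun := fun x => ⟨A.symm x.1, fun g => A.injective ((hA g _).trans (by
      rw [A.apply_symm_apply]; exact (mem_invariantRing_iff G).1 x.2 g))⟩
    left_inv := fun x => Subtype.ext (A.symm_apply_apply x.1)
    right_inv := fun x => Subtype.ext (A.apply_symm_apply x.1) }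

/-- Frobenius push-forward of an isomorphism. -/
def frobPushCongr {A : Type*} [CommRing A] (p e : ℕ) [ExpChar A p] {M N : Type*} [AddCommGroup M]
    [Module A M] [AddCommGroup N] [Module A N] (f : M ≃ₗ[A] N) :
    FrobPush p e M ≃ₗ[A] FrobPush p e N :=
  { (f.toAddEquiv : FrobPush p e M ≃+ FrobPush p e N) with
    map_smul' := fun r x => f.map_smul (r ^ p ^ e) x }

end CovariantsFunctor

/-! ### Counting homomorphisms into a Frobenius push-forward -/

section Counting

variable (k : Type*) [Field k] (p e : ℕ) [ExpChar k p]
  {S : Type*} [CommRing S] {X : Type*} [AddCommGroup X] [Module S X] [Module k X]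
  [SMulCommClass k S X] {U : Type*} [AddCommGroup U] [Module k U]

/-- The original scalars act linearly on a Frobenius push-forward. -/
def frobScalar : S →+* Module.End k (FrobPush p e X) where
  toFun s :=
    { toFun := fun y => toFrob p e X (s • (toFrob p e X).symm y)
      map_add' := fun x y => by rw [map_add, smul_add, map_add]
      map_smul' := fun c y => by
        obtain ⟨x, rfl⟩ := (toFrob p e X).surjective y
        rw [smul_toFrob, AddEquiv.symm_apply_apply, AddEquiv.symm_apply_apply, ← smul_comm,
          RingHom.id_apply, smul_toFrob] }
  map_one' := LinearMap.ext fun y => by simp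
  map_mul' s t := LinearMap.ext fun y => by simp [mul_smul]
  map_zero' := LinearMap.ext fun y => by simp
  map_add' s t := LinearMap.ext fun y => by simp [add_smul]

theorem frobScalar_toFrob (s : S) (x : X) :
    frobScalar k p e s (toFrob p e X x) = toFrob p e X (s • x) := rfl

/-- The linear maps to a Frobenius push-forward, with the action of the original scalars; these
scalars are recorded to keep the two module structures apart. -/
def FrobHom (_S U X : Type*) [AddCommGroup U] [Module k U] [AddCommGroup X] [Module k X] : Type _ :=
  U →ₗ[k] FrobPush p e X

namespace FrobHom

instance : AddCommGroup (FrobHom k p e S U X) :=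
  inferInstanceAs (AddCommGroup (U →ₗ[k] FrobPush p e X))

instance : Module k (FrobHom k p e S U X) := inferInstanceAs (Module k (U →ₗ[k] FrobPush p e X))

instance : Module S (FrobHom k p e S U X) where
  smul s f := (frobScalar k p e s : Module.End k (FrobPush p e X)) ∘ₗ (f : U →ₗ[k] FrobPush p e X)
  one_smul f := LinearMap.ext fun u => by
    change frobScalar k p e (1 : S) _ = _
    rw [map_one]; rfl
  mul_smul s t f := LinearMap.ext fun u => by
    change frobScalar k p e (s * t) _ = _
    rw [map_mul]; rfl
  smul_zero s := LinearMap.ext fun u => map_zero (frobScalar k p e s : Module.End k (FrobPush p e X))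
  smul_add s f f' := LinearMap.ext fun u =>
    map_add (frobScalar k p e s : Module.End k (FrobPush p e X)) _ _
  add_smul s t f := LinearMap.ext fun u => by
    change frobScalar k p e (s + t) _ = _
    rw [map_add]; rfl
  zero_smul f := LinearMap.ext fun u => by
    change frobScalar k p e (0 : S) _ = _
    rw [map_zero]; rfl

instance : SMulCommClass k S (FrobHom k p e S U X) where
  smul_comm c s f := LinearMap.ext fun u =>
    ((frobScalar k p e s : Module.End k (FrobPush p e X)).map_smul c
      ((show U →ₗ[k] FrobPush p e X from f) u)).symm

/-- The representation on the linear maps to a Frobenius push-forward. -/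
def rep (S : Type*) {G : Type*} [Group G] (τ : Representation k G U) (π : Representation k G X) :
    Representation k G (FrobHom k p e S U X) := Representation.linHom τ (frobRep p e π)

end FrobHom

variable {k p e}

/-- The action on Hom-spaces is semilinear for the original scalars. -/
theorem FrobHom.isSemilinear_rep {G : Type*} [Group G] [MulSemiringAction G S]
    (τ : Representation k G U) {π : Representation k G X} (hπ : IsSemilinear S π) :
    IsSemilinear S (FrobHom.rep k p e S τ π) := by
  intro g s f
  refine LinearMap.ext fun u => ?_
  obtain ⟨x, hx⟩ := (toFrob p e X).surjective ((show U →ₗ[k] FrobPush p e X from f) (τ g⁻¹ u))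
  change frobRep p e π g (frobScalar k p e s ((show U →ₗ[k] FrobPush p e X from f) (τ g⁻¹ u))) =
    frobScalar k p e (g • s)
      (frobRep p e π g ((show U →ₗ[k] FrobPush p e X from f) (τ g⁻¹ u)))
  rw [← hx, frobScalar_toFrob, frobRep_toFrob, frobRep_toFrob, frobScalar_toFrob, hπ]

/-- A homomorphism killed by `s` takes values in the kernel of `s`, whose dimension the Frobenius
twist does not change. -/
theorem finrank_ker_smulMap_frobHom_le [PerfectRing k p] [FiniteDimensional k U]
    [FiniteDimensional k X] (s : S) :
    Module.finrank k (LinearMap.ker (smulMap k (FrobHom k p e S U X) s)) ≤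
      Module.finrank k U * Module.finrank k (LinearMap.ker (smulMap k X s)) := by
  have := finite_frobPush (k := k) (p := p) (e := e) X
  let N := LinearMap.ker (frobScalar k p e s : Module.End k (FrobPush p e X))
  have hN : Module.finrank k N = Module.finrank k (LinearMap.ker (smulMap k X s)) := by
    refine congrArg Cardinal.toNat (rank_eq_of_equiv_equiv (iterateFrobenius k p e)
      (AddEquiv.refl _ : N ≃+ LinearMap.ker (smulMap k X s))
      (bijective_iterateFrobenius k p e) fun r y => ?_)
    rfl
  rw [← hN, ← Module.finrank_linearMap k k]
  let T : LinearMap.ker (smulMap k (FrobHom k p e S U X) s) →ₗ[k] (U →ₗ[k] N) :=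
    { toFun := fun f => LinearMap.codRestrict N (show U →ₗ[k] FrobPush p e X from f.1)
        fun u => LinearMap.congr_fun (show (frobScalar k p e s : Module.End k (FrobPush p e X)) ∘ₗ
          (show U →ₗ[k] FrobPush p e X from f.1) = 0 from f.2) u
      map_add' := fun f f' => rfl
      map_smul' := fun c f => rfl }
  refine LinearMap.finrank_le_finrank_of_injective (f := T) fun f f' h => Subtype.ext ?_
  exact congrArg (fun g => N.subtype ∘ₗ g) h

/-- Counting the homomorphisms from a representation to a Frobenius push-forward: upper bound for
the dimension. -/
theorem finrank_mul_le_card_mul_finrank_intertwiningMap {G : Type*} [Group G] [Fintype G]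
    [MulSemiringAction G S] [PerfectRing k p] [FiniteDimensional k U] [FiniteDimensional k X]
    (τ : Representation k G U) {π : Representation k G X} (hπ : IsSemilinear S π) (v : S) :
    Module.finrank k U * Module.finrank k X ≤
      Nat.card G * Module.finrank k (τ.IntertwiningMap (frobRep p e π)) +
        Module.finrank k U * Module.finrank k (LinearMap.ker (smulMap k X (orbitDet G v))) := by
  have := finite_frobPush (k := k) (p := p) (e := e) X
  have hfd : FiniteDimensional k (FrobHom k p e S U X) :=
    inferInstanceAs (FiniteDimensional k (U →ₗ[k] FrobPush p e X))
  have h1 := finrank_le_card_mul_invariants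
    (FrobHom.isSemilinear_rep (k := k) (p := p) (e := e) τ hπ) v
  have h2 := finrank_ker_smulMap_frobHom_le (k := k) (p := p) (e := e) (S := S) (U := U) (X := X)
    (orbitDet G v)
  have h3 : Module.finrank k (FrobHom k p e S U X) = Module.finrank k U * Module.finrank k X :=
    (Module.finrank_linearMap k k U (FrobPush p e X)).trans (by rw [finrank_frobPush])
  have h4 := (Representation.invariantsEquivIntertwiningMap τ (frobRep p e π)).finrank_eq
  exact h3.ge.trans (h1.trans (Nat.add_le_add (Nat.mul_le_mul_left _ h4.le) h2))

/-- Counting the homomorphisms from a representation to a Frobenius push-forward: lower bound for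
the dimension. -/
theorem card_mul_finrank_intertwiningMap_le {G : Type*} [Group G] [Fintype G]
    [MulSemiringAction G S] [PerfectRing k p] [FiniteDimensional k U] [FiniteDimensional k X]
    (τ : Representation k G U) {π : Representation k G X} (hπ : IsSemilinear S π) (v : S) :
    Nat.card G * Module.finrank k (τ.IntertwiningMap (frobRep p e π)) ≤
      Module.finrank k U * Module.finrank k X + Nat.card G *
        (Module.finrank k U * Module.finrank k (LinearMap.ker (smulMap k X (orbitDet G v)))) := by
  have := finite_frobPush (k := k) (p := p) (e := e) X
  have hfd : FiniteDimensional k (FrobHom k p e S U X) :=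
    inferInstanceAs (FiniteDimensional k (U →ₗ[k] FrobPush p e X))
  have h1 := card_mul_invariants_le_finrank
    (FrobHom.isSemilinear_rep (k := k) (p := p) (e := e) τ hπ) v
  have h2 := finrank_ker_smulMap_frobHom_le (k := k) (p := p) (e := e) (S := S) (U := U) (X := X)
    (orbitDet G v)
  have h3 : Module.finrank k (FrobHom k p e S U X) = Module.finrank k U * Module.finrank k X :=
    (Module.finrank_linearMap k k U (FrobPush p e X)).trans (by rw [finrank_frobPush])
  have h4 := (Representation.invariantsEquivIntertwiningMap τ (frobRep p e π)).finrank_eq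
  refine (Nat.mul_le_mul_left _ h4.ge).trans (h1.trans ?_)
  exact Nat.add_le_add h3.le (Nat.mul_le_mul_left _ h2)

end Counting

end GenFSig

namespace GenFSig

/-! ### Multiplicities and their limits -/

section Decomposition

/-- `frobMult` chooses some decomposition; uniqueness makes the choice irrelevant. -/
theorem frobMult_eq {A : Type*} [CommRing A] {p : ℕ} [ExpChar A p] {ι : Type*} {M : ι → Type*}
    [∀ j, AddCommGroup (M j)] [∀ j, Module A (M j)] {N : Type*} [AddCommGroup N] [Module A N]
    {e : ℕ} {c : ι → ℕ} (h : ∀ c', IsFrobDecomp A p M N e c' ↔ c' = c) :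
    frobMult A p M N e = c := by
  have hex : ∃ c', IsFrobDecomp A p M N e c' := ⟨c, (h c).2 rfl⟩
  rw [frobMult, dif_pos hex]
  exact (h _).1 hex.choose_spec

theorem isFrobDecomp_congr {A : Type*} [CommRing A] {p : ℕ} [ExpChar A p] {ι : Type*}
    {M : ι → Type*} [∀ j, AddCommGroup (M j)] [∀ j, Module A (M j)] {N N' : Type*}
    [AddCommGroup N] [Module A N] [AddCommGroup N'] [Module A N'] (f : N ≃ₗ[A] N')
    (e : ℕ) (c : ι → ℕ) : IsFrobDecomp A p M N e c ↔ IsFrobDecomp A p M N' e c :=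
  ⟨fun ⟨h⟩ => ⟨(frobPushCongr p e f).symm.trans h⟩, fun ⟨h⟩ => ⟨(frobPushCongr p e f).trans h⟩⟩

variable {k : Type u} [Field k] (p : ℕ) [ExpChar k p]
  {V : Type*} [AddCommGroup V] [Module k V]
  {G : Subgroup (LinearMap.GeneralLinearGroup k V)}
  {U U' : Type*} [AddCommGroup U] [Module k U] [AddCommGroup U'] [Module k U']

/-- The dimension of the space of homomorphisms from a representation `τ` to the Frobenius
push-forward of the fiber of `S ⊗ σ` modulo `p ^ e`-th powers. -/
def homMult (τ : Representation k G U) (σ : Representation k G U') (e : ℕ) : ℕ :=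
  Module.finrank k (τ.IntertwiningMap (frobRep p e (PowFiber.rep σ (p ^ e))))

variable [IsAlgClosed k] [FiniteDimensional k V] [Finite G]

/-- The decompositions of the Frobenius push-forwards of modules of covariants. -/
theorem isFrobDecomp_covariants_iff (hcard : (Nat.card G : k) ≠ 0)
    (hG : ∀ g ∈ G, ¬ IsPseudoReflection g) {ι : Type*} [Fintype ι] {W : ι → Type*}
    [∀ i, AddCommGroup (W i)] [∀ i, Module k (W i)] (ρ : ∀ i, Representation k G (W i))
    (hirr : ∀ i, (ρ i).IsIrreducible) (hne : ∀ i j, i ≠ j → IsEmpty ((ρ i).Equiv (ρ j)))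
    (hcomplete : ∀ (U : Type u) [AddCommGroup U] [Module k U] (σ : Representation k G U),
      σ.IsIrreducible → ∃ i, Nonempty (σ.Equiv (ρ i)))
    [FiniteDimensional k U] (σ : Representation k G U) (e : ℕ) (c : ι → ℕ) :
    IsFrobDecomp (invariantRing G) p (fun j => covariants G (ρ j)) (covariants G σ) e c ↔
      c = fun j => homMult p (ρ j) σ e := by
  classical
  have : Fintype G := Fintype.ofFinite G
  have : NeZero (Nat.card G : k) := ⟨hcard⟩
  have hfdW := fun i => finiteDimensional_of_isIrreducible (hirr i)
  obtain ⟨hfd, -⟩ := finrank_powFiber_le (k := k) (V := V) (W := U) (p ^ e)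
  have := finite_frobPush (k := k) (p := p) (e := e) (PowFiber k V U (p ^ e))
  obtain ⟨E⟩ := nonempty_covariants_equiv_frobPush σ p e hcard
  have key : ∀ c' : ι → ℕ,
      Nonempty ((frobRep p e (PowFiber.rep σ (p ^ e))).Equiv
        (piRep fun s : (Σ i, Fin (c' i)) => ρ s.1)) → c' = fun j => homMult p (ρ j) σ e := by
    rintro c' ⟨φ⟩
    funext j
    rw [homMult, (intertwiningCongr (ρ j) φ).finrank_eq,
      finrank_intertwiningMap_piRep ρ hirr hne c' j]
  constructor
  · rintro ⟨F⟩
    -- The decomposition of modules comes from one of representations, whose multiplicities are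
    -- dimensions of Hom-spaces.
    exact key c (nonempty_equiv_of_covariants hG
      ((E.symm.trans F).trans (covariantsSigmaEquiv ρ c).symm))
  · rintro rfl
    obtain ⟨c', ⟨φ⟩⟩ := exists_equiv_piRep ρ hcomplete (frobRep p e (PowFiber.rep σ (p ^ e)))
    rw [← key c' ⟨φ⟩]
    exact ⟨(E.trans (covariantsCongr φ)).trans (covariantsSigmaEquiv ρ c')⟩

/-- The decompositions of the Frobenius push-forwards of the invariant ring. -/
theorem isFrobDecomp_invariantRing_iff (hcard : (Nat.card G : k) ≠ 0)
    (hG : ∀ g ∈ G, ¬ IsPseudoReflection g) {ι : Type*} [Fintype ι] {W : ι → Type*}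
    [∀ i, AddCommGroup (W i)] [∀ i, Module k (W i)] (ρ : ∀ i, Representation k G (W i))
    (hirr : ∀ i, (ρ i).IsIrreducible) (hne : ∀ i j, i ≠ j → IsEmpty ((ρ i).Equiv (ρ j)))
    (hcomplete : ∀ (U : Type u) [AddCommGroup U] [Module k U] (σ : Representation k G U),
      σ.IsIrreducible → ∃ i, Nonempty (σ.Equiv (ρ i))) (e : ℕ) (c : ι → ℕ) :
    IsFrobDecomp (invariantRing G) p (fun j => covariants G (ρ j)) (invariantRing G) e c ↔
      c = fun j => homMult p (ρ j) (Representation.trivial k G k) e :=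
  (isFrobDecomp_congr (covariantsTrivialEquiv (G := G)).symm e c).trans
    (isFrobDecomp_covariants_iff p hcard hG ρ hirr hne hcomplete (Representation.trivial k G k) e c)

/-- The asymptotic behaviour of the multiplicities. -/
theorem tendsto_homMult (hp : 1 < p) (hcard : (Nat.card G : k) ≠ 0)
    (hG : ∀ g ∈ G, ¬ IsPseudoReflection g) [FiniteDimensional k U] [FiniteDimensional k U']
    (τ : Representation k G U) (σ : Representation k G U') :
    Tendsto (fun e => (homMult p τ σ e : ℝ) / (p : ℝ) ^ (Module.finrank k V * e)) atTop
      (𝓝 ((Module.finrank k U' : ℝ) * (Module.finrank k U : ℝ) / (Nat.card G : ℝ))) := by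
  have : Fintype G := Fintype.ofFinite G
  obtain ⟨v, hv⟩ := exists_orbitDet_ne_zero G hG
  obtain ⟨A, hA⟩ := exists_mul_finrank_ker_le hv
  have hn : (0 : ℝ) < Nat.card G := by exact_mod_cast Nat.card_pos
  have hp0 : (0 : ℝ) < p := by exact_mod_cast lt_trans zero_lt_one hp
  rw [tendsto_iff_norm_sub_tendsto_zero]
  -- The deviation from the limit is at most `dim U * A * dim U' / p ^ e`, with `A` the constant of
  -- the kernel bound.
  have hlim : Tendsto (fun e => (Module.finrank k U * A * Module.finrank k U' : ℝ) *
      ((p : ℝ)⁻¹) ^ e) atTop (𝓝 0) := by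
    have := (tendsto_pow_atTop_nhds_zero_of_lt_one (inv_nonneg.2 hp0.le)
      (inv_lt_one_of_one_lt₀ (by exact_mod_cast hp : (1 : ℝ) < p))).const_mul
      (Module.finrank k U * A * Module.finrank k U' : ℝ)
    rwa [mul_zero] at this
  refine squeeze_zero (fun _ => norm_nonneg _) (fun e => ?_) hlim
  obtain ⟨hfd, -⟩ := finrank_powFiber_le (k := k) (V := V) (W := U') (p ^ e)
  have h1 := finrank_mul_le_card_mul_finrank_intertwiningMap (p := p) (e := e) τ
    (PowFiber.isSemilinear_rep σ (p ^ e)) (SymmetricAlgebra.ι k V v)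
  have h2 := card_mul_finrank_intertwiningMap_le (p := p) (e := e) τ
    (PowFiber.isSemilinear_rep σ (p ^ e)) (SymmetricAlgebra.ι k V v)
  have h3 := hA U' (p ^ e)
  rw [finrank_powFiber p e σ hcard] at h1 h2
  change _ ≤ _ * homMult p τ σ e + _ at h1
  change _ * homMult p τ σ e ≤ _ at h2
  set K := Module.finrank k (LinearMap.ker (smulMap k (PowFiber k V U' (p ^ e))
    (orbitDet G (SymmetricAlgebra.ι k V v))))
  set m := homMult p τ σ e
  have hq : (0 : ℝ) < (p : ℝ) ^ e := pow_pos hp0 e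
  have hn1 : (1 : ℝ) ≤ Nat.card G := by exact_mod_cast Nat.card_pos
  have hpow : (p : ℝ) ^ (Module.finrank k V * e) = ((p : ℝ) ^ e) ^ Module.finrank k V := by
    rw [← pow_mul, mul_comm]
  rw [hpow, inv_pow]
  have h1' : (Module.finrank k U : ℝ) * (((p : ℝ) ^ e) ^ Module.finrank k V *
      Module.finrank k U') ≤ Nat.card G * m + Module.finrank k U * K := by exact_mod_cast h1
  have h2' : (Nat.card G : ℝ) * m ≤ Module.finrank k U * (((p : ℝ) ^ e) ^ Module.finrank k V *
      Module.finrank k U') + Nat.card G * (Module.finrank k U * K) := by exact_mod_cast h2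
  have h3' : (p : ℝ) ^ e * K ≤ A * ((p : ℝ) ^ e) ^ Module.finrank k V * Module.finrank k U' := by
    exact_mod_cast h3
  generalize (p : ℝ) ^ e = q at *
  have hQ : 0 < q ^ Module.finrank k V := pow_pos hq _
  generalize q ^ Module.finrank k V = Q at *
  generalize (Nat.card G : ℝ) = n at *
  have hu : (0 : ℝ) ≤ Module.finrank k U := Nat.cast_nonneg _
  generalize (Module.finrank k U : ℝ) = u at *
  generalize (Module.finrank k U' : ℝ) = u' at *
  have hK : (0 : ℝ) ≤ K := Nat.cast_nonneg _
  generalize (K : ℝ) = K at *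
  generalize (m : ℝ) = m at *
  generalize (A : ℝ) = a at *
  -- The two counting bounds have errors `u * K` and `n * (u * K)`; the second dominates because `n
  -- ≥ 1`.
  have h4 : |n * m - u' * u * Q| ≤ n * (u * K) := by
    have h5 : u * K ≤ n * (u * K) := le_mul_of_one_le_left (mul_nonneg hu hK) hn1
    rw [abs_le]
    constructor <;> linarith
  have h6 : m / Q - u' * u / n = (n * m - u' * u * Q) / (n * Q) := by
    field_simp
  have h7 : K ≤ a * Q * u' / q := by
    rw [le_div_iff₀ hq]
    linarith
  rw [Real.norm_eq_abs, h6, abs_div, abs_of_pos (mul_pos hn hQ), div_le_iff₀ (mul_pos hn hQ)]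
  refine h4.trans ((mul_le_mul_of_nonneg_left (mul_le_mul_of_nonneg_left h7 hu) hn.le).trans_eq ?_)
  field_simp

end Decomposition

end GenFSig

end

set_option maxHeartbeats 1000000 in
theorem mainTheorem4 {k : Type u} [Field k] [IsAlgClosed k] (p : ℕ) [Fact p.Prime] [CharP k p]
    {V : Type v} [AddCommGroup V] [Module k V] [FiniteDimensional k V]
    (G : Subgroup (LinearMap.GeneralLinearGroup k V)) [Finite G]
    (hp : ¬ p ∣ Nat.card G)
    (hG : ∀ g ∈ G, ¬ GenFSig.IsPseudoReflection g)
    -- a complete set `V₀ = k, V₁, …, Vₙ` of pairwise non-isomorphic irreducible representations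
    (n : ℕ) (W : Fin (n + 1) → Type w) [∀ i, AddCommGroup (W i)] [∀ i, Module k (W i)]
    (ρ : ∀ i, Representation k G (W i))
    (hirr : ∀ i, (ρ i).IsIrreducible)
    (htriv : Nonempty ((ρ 0).Equiv (Representation.trivial k G k)))
    (hne : ∀ i j, i ≠ j → IsEmpty ((ρ i).Equiv (ρ j)))
    (hcomplete : ∀ (U : Type u) [AddCommGroup U] [Module k U] (σ : Representation k G U),
      σ.IsIrreducible → ∃ i, Nonempty (σ.Equiv (ρ i))) :
    let R := GenFSig.invariantRing G
    let M : (i : Fin (n + 1)) → Submodule R (SymmetricAlgebra k V ⊗[k] W i) :=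
      fun i => GenFSig.covariants G (ρ i)
    let d := Module.finrank k V
    let sR : Fin (n + 1) → ℝ := fun j => GenFSig.genFSignature R p (fun j => M j) R d j
    let sM : Fin (n + 1) → Fin (n + 1) → ℝ :=
      fun i j => GenFSig.genFSignature R p (fun j => M j) (M i) d j
    -- the decompositions exist and their multiplicities are unique
    (∀ e, ∃! c, GenFSig.IsFrobDecomp R p (fun j => M j) R e c) ∧
    (∀ i e, ∃! c, GenFSig.IsFrobDecomp R p (fun j => M j) (M i) e c) ∧
    -- the limits exist
    (∀ j, Tendsto (GenFSig.frobMultRatio R p (fun j => M j) R d j) atTop (𝓝 (sR j))) ∧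
    (∀ i j, Tendsto (GenFSig.frobMultRatio R p (fun j => M j) (M i) d j) atTop (𝓝 (sM i j))) ∧
    -- their values
    ∀ i j,
      sM i j = (Module.finrank k (W i) : ℝ) * sR j ∧
      (Module.finrank k (W i) : ℝ) * sR j =
        (Module.finrank k (W i) : ℝ) * (Module.finrank k (W j) : ℝ) / (Nat.card G : ℝ) ∧
      (Module.finrank k (W i) : ℝ) * (Module.finrank k (W j) : ℝ) / (Nat.card G : ℝ) =
        (Module.finrank R (M i) : ℝ) * (Module.finrank R (M j) : ℝ) / (Nat.card G : ℝ) := by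
  intro R M d sR sM
  have hprime : p.Prime := Fact.out
  have hcard : (Nat.card G : k) ≠ 0 := fun h => hp ((CharP.cast_eq_zero_iff k p _).1 h)
  have hfdW := fun i => GenFSig.finiteDimensional_of_isIrreducible (hirr i)
  have hM : ∀ i e c, GenFSig.IsFrobDecomp R p (fun j => M j) (M i) e c ↔
      c = fun j => GenFSig.homMult p (ρ j) (ρ i) e := fun i e c =>
    GenFSig.isFrobDecomp_covariants_iff p hcard hG ρ hirr hne hcomplete (ρ i) e c
  have hR : ∀ e c, GenFSig.IsFrobDecomp R p (fun j => M j) R e c ↔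
      c = fun j => GenFSig.homMult p (ρ j) (Representation.trivial k G k) e := fun e c =>
    GenFSig.isFrobDecomp_invariantRing_iff p hcard hG ρ hirr hne hcomplete e c
  have limM : ∀ i j, Tendsto (GenFSig.frobMultRatio R p (fun j => M j) (M i) d j) atTop
      (𝓝 ((Module.finrank k (W i) : ℝ) * (Module.finrank k (W j) : ℝ) / (Nat.card G : ℝ))) := by
    intro i j
    refine (GenFSig.tendsto_homMult p hprime.one_lt hcard hG (ρ j) (ρ i)).congr fun e => ?_
    rw [GenFSig.frobMultRatio, GenFSig.frobMult_eq (hM i e)]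
  have limR : ∀ j, Tendsto (GenFSig.frobMultRatio R p (fun j => M j) R d j) atTop
      (𝓝 ((Module.finrank k (W j) : ℝ) / (Nat.card G : ℝ))) := by
    intro j
    -- The ring itself is the module of covariants of the trivial representation, of dimension one.
    have h := GenFSig.tendsto_homMult p hprime.one_lt hcard hG (ρ j) (Representation.trivial k G k)
    rw [Module.finrank_self, Nat.cast_one, one_mul] at h
    refine h.congr fun e => ?_
    rw [GenFSig.frobMultRatio, GenFSig.frobMult_eq (hR e)]
  have hsM : ∀ i j, sM i j =
      (Module.finrank k (W i) : ℝ) * (Module.finrank k (W j) : ℝ) / (Nat.card G : ℝ) :=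
    fun i j => (limM i j).limUnder_eq
  have hsR : ∀ j, sR j = (Module.finrank k (W j) : ℝ) / (Nat.card G : ℝ) :=
    fun j => (limR j).limUnder_eq
  refine ⟨fun e => ⟨_, (hR e _).2 rfl, fun c hc => (hR e c).1 hc⟩,
    fun i e => ⟨_, (hM i e _).2 rfl, fun c hc => (hM i e c).1 hc⟩,
    fun j => ?_, fun i j => ?_, fun i j => ⟨?_, ?_, ?_⟩⟩
  · rw [hsR]
    exact limR j
  · rw [hsM]
    exact limM i j
  · rw [hsM, hsR, mul_div_assoc]
  · rw [hsR, mul_div_assoc]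
  · rw [show Module.finrank R (M i) = Module.finrank k (W i) from
        GenFSig.finrank_covariants (ρ i) hG,
      show Module.finrank R (M j) = Module.finrank k (W j) from
        GenFSig.finrank_covariants (ρ j) hG]
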